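/- Let $\mathcal C$ be a small category with a Grothendieck topology $J$ and let $U$ be an object of $\mathcal C$. Sheaves and presheaves are sheaves and presheaves of abelian groups on $\mathcal C$, and $A\otimes B$ is the tensor product of sheaves (respectively of presheaves). Write $H^n(U,-)=\operatorname{Ext}^n(\mathbb Z_U,-)$ for the derived functors of $F\mapsto F(U)$ on sheaves, where $\mathbb Z_U$ is the sheaf associated with $V\mapsto\mathbb Z[\operatorname{Hom}(V,U)]$. The (derived) cup product $H^r(U,A)\times H^s(U,B)\to H^{r+s}(U,A\otimes B)$ sends $x:\mathbb Z_U\to A[r]$, $y:\mathbb Z_U\to B[s]$ to the composition of the diagonal $\mathbb Z_U\to\mathbb Z_U\otimes\mathbb Z_U$, of $x\otimes^{\mathbf L}y$ and of the canonical morphism $A\otimes^{\mathbf L}B\to A\otimes B$, with the sign normalised such that the product is strictly compatible with connecting homomorphisms in the first variable. For a family $\mathfrak U=(U_i\to U)_{i\in I}$ which generates the sieve $S$ on $U$, let $N_n(V)$ be the set of $(n+1)$-tuples $(x_0,\dots,x_n)$ of morphisms from $V$ to members of the family with the same composite $V\to U$; thus $N_n$ is the disjoint union of the presheaves represented by the fibre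 products $U_{i_0}\times_U\dots\times_U U_{i_n}$ if these exist. The complex of Čech cochains of a presheaf $P$ is $C^n(\mathfrak U,P)=\operatorname{Hom}(\mathbb Z[N_n],P)$, i.e. $\prod_{i_0,\dots,i_n}P(U_{i_0}\times_U\dots\times_U U_{i_n})$ if the fibre products exist, and $\check H^n(\mathfrak U,P)$ is its cohomology. As $\mathbb Z[N_\bullet]$ is a resolution of $\mathbb Z[S]$, there is a canonical map $\check H^n(\mathfrak U,P)\to\operatorname{Ext}^n(\mathbb Z[S],P)$ to the derived functors on presheaves of $\check H^0(\mathfrak U,-)=\operatorname{Hom}(\mathbb Z[S],-)$; these carry a derived cup product defined as above by means of the diagonal of $\mathbb Z[S]$. The Alexander–Whitney formula $$(a\cup b)(x_0,\dots,x_{r+s})=a(x_0,\dots,x_r)\otimes b(x_r,\dots,x_{r+s})$$ defines a cup product $\check H^r(\mathfrak U,P)\times\check H^s(\mathfrak U,Q)\to\check H^{r+s}(\mathfrak U,P\otimes Q)$; for sheaves $A$, $B$ one composes it with the morphism induced by the canonical map from the presheaf tensor product to the sheaf $A\otimes B$. Let $\check H^n(U,-)=\varinjlim\check H^n(\mathfrak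 U,-)$, the limit over the covering sieves of $U$, with the induced cup product. For a sheaf $F$ and a covering family $\mathfrak U$ (i.e. $S\in J(U)$), sheafification induces the edge morphism $\operatorname{Ext}^n(\mathbb Z[S],F)\to H^n(U,F)$, hence edge morphisms $\check H^n(\mathfrak U,F)\to H^n(U,F)$ and $\check H^n(U,F)\to H^n(U,F)$. Čech cohomology is said to agree with derived functor cohomology in degree $n$ for $F$ if the respective edge morphism is an isomorphism. **Theorem.** 1. For every family $\mathfrak U$ of morphisms with target $U$ and all presheaves $P,Q$, the map $\check H^*(\mathfrak U,-)\to\operatorname{Ext}^*(\mathbb Z[S],-)$ takes the Alexander–Whitney cup product to the derived cup product on $\operatorname{Ext}^*(\mathbb Z[S],-)$. 2. Let $\mathfrak U$ be a covering family, $A,B$ sheaves and $r,s\ge0$. The edge morphisms $\operatorname{Ext}^*(\mathbb Z[S],-)\to H^*(U,-)$ and $\check H^*(\mathfrak U,-)\to H^*(U,-)$ take the cup products to the cup product of derived functor cohomology; in particular, for cocycles $a\in C^r(\mathfrak U,A)$, $b\in C^s(\mathfrak U,B)$ the cup product of their classes in $H^*(U,-)$ is the class of a cocycle given by the Alexander–Whitney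 formula. Consequently, if $\check H^*(\mathfrak U,-)$ agrees with derived functor cohomology in degree $r$ for $A$ and in degree $s$ for $B$, the cup product $H^r(U,A)\times H^s(U,B)\to H^{r+s}(U,A\otimes B)$ is the composition of the Čech cup product with the edge morphism; and if they agree also in degree $r+s$ for $A\otimes B$, the two cup products coincide under the edge isomorphisms. 3. The statements on $\check H^*$ and its cup product in 2 also hold for $\check H^*(U,-)$ in place of $\check H^*(\mathfrak U,-)$. 4. For every sheaf $F$ and $n=0,1$ the edge morphism $\check H^n(U,F)\to H^n(U,F)$ is an isomorphism. For all $\xi\in H^1(U,A)$, $\eta\in H^0(U,B)$ there are a covering family of $U$, a $1$-cocycle $a$ representing $\xi$ and a $0$-cocycle $b$ representing $\eta$ on it such that $\xi\cup\eta\in H^1(U,A\otimes B)$ is the class of a $1$-cocycle $c$ with $c(x_0,x_1)=a(x_0,x_1)\otimes b(x_1)$. -/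

import Mathlib

open CategoryTheory Abelian Limits MonoidalCategory Opposite

universe w v u

namespace CechCup

noncomputable section

section Resolutions

variable {𝒜 : Type u} [Category.{v} 𝒜] [Abelian 𝒜]

/-- A resolution `⋯ ⟶ X 1 ⟶ X 0 ⟶ K ⟶ 0` of an object `K` of an abelian category. -/
structure Resolution (K : 𝒜) where
  X : ℕ → 𝒜
  d : ∀ n, X (n + 1) ⟶ X n
  ε : X 0 ⟶ K
  d_ε : d 0 ≫ ε = 0
  d_d : ∀ n, d (n + 1) ≫ d n = 0
  epi : Epi ε
  exact₀ : (ShortComplex.mk (d 0) ε d_ε).Exact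
  exact_succ : ∀ n, (ShortComplex.mk (d (n + 1)) (d n) (d_d n)).Exact

namespace Resolution

variable {K : 𝒜} (R : Resolution K)

/-- The resolution `⋯ ⟶ X 2 ⟶ X 1 ⟶ ker ε ⟶ 0`. -/
def shift : Resolution (kernel R.ε) where
  X n := R.X (n + 1)
  d n := R.d (n + 1)
  ε := kernel.lift R.ε (R.d 0) R.d_ε
  d_ε := by
    rw [← cancel_mono (kernel.ι R.ε)]
    simp [R.d_d]
  d_d n := R.d_d (n + 1)
  epi := R.exact₀.epi_kernelLift
  exact₀ := by
    let φ : ShortComplex.mk (R.d 1) (kernel.lift R.ε (R.d 0) R.d_ε) (by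
        rw [← cancel_mono (kernel.ι R.ε)]
        simp [R.d_d]) ⟶ ShortComplex.mk (R.d 1) (R.d 0) (R.d_d 0) :=
      { τ₁ := 𝟙 _, τ₂ := 𝟙 _, τ₃ := kernel.ι R.ε }
    have : Epi φ.τ₁ := inferInstanceAs (Epi (𝟙 _))
    have : IsIso φ.τ₂ := inferInstanceAs (IsIso (𝟙 _))
    have : Mono φ.τ₃ := inferInstanceAs (Mono (kernel.ι R.ε))
    exact (ShortComplex.exact_iff_of_epi_of_isIso_of_mono φ).2 (R.exact_succ 0)
  exact_succ n := R.exact_succ (n + 1)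

/-- The short complex `ker ε ⟶ X 0 ⟶ K`. -/
abbrev head : ShortComplex 𝒜 := ShortComplex.mk (kernel.ι R.ε) R.ε (kernel.condition _)

lemma head_shortExact : R.head.ShortExact :=
  have := R.epi
  { exact := ShortComplex.exact_kernel R.ε }

/-- The `n`-cocycles of the cochain complex `Hom(X •, F)`. -/
def cocycles (F : 𝒜) (n : ℕ) : AddSubgroup (R.X n ⟶ F) :=
  (Preadditive.leftComp F (R.d n)).ker

lemma mem_cocycles {F : 𝒜} {n : ℕ} (a : R.X n ⟶ F) : a ∈ R.cocycles F n ↔ R.d n ≫ a = 0 :=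
  Iff.rfl

/-- The `n`-coboundaries of the cochain complex `Hom(X •, F)`. -/
def coboundaries (F : 𝒜) : ∀ n : ℕ, AddSubgroup (R.X n ⟶ F)
  | 0 => ⊥
  | n + 1 => (Preadditive.leftComp F (R.d n)).range

/-- The `n`-th cohomology group of the cochain complex `Hom(X •, F)`. -/
abbrev Cohomology (F : 𝒜) (n : ℕ) : Type v :=
  R.cocycles F n ⧸ (R.coboundaries F n).addSubgroupOf (R.cocycles F n)

lemma coboundary_mem (F : 𝒜) (n : ℕ) (h : R.X n ⟶ F) : R.d n ≫ h ∈ R.coboundaries F (n + 1) :=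
  ⟨h, rfl⟩

/-- The morphism `K ⟶ F` induced by a `0`-cocycle. -/
def desc₀ (F : 𝒜) (a : R.cocycles F 0) : K ⟶ F :=
  have := R.epi
  R.exact₀.desc a.1 a.2

lemma ε_desc₀ (F : 𝒜) (a : R.cocycles F 0) : R.ε ≫ R.desc₀ F a = a.1 :=
  have := R.epi
  R.exact₀.g_desc a.1 a.2

/-- An `(n + 1)`-cocycle of a resolution is an `n`-cocycle of the shifted resolution. -/
def shiftCocycles (F : 𝒜) (n : ℕ) : R.cocycles F (n + 1) →+ R.shift.cocycles F n :=
  AddMonoidHom.mk' (fun a ↦ ⟨a.1, a.2⟩) fun _ _ ↦ rfl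

/-- A morphism of resolutions over a morphism `k : K ⟶ K'`. -/
structure Hom {K K' : 𝒜} (R : Resolution K) (R' : Resolution K') (k : K ⟶ K') where
  f : ∀ n, R.X n ⟶ R'.X n
  comm : ∀ n, f (n + 1) ≫ R'.d n = R.d n ≫ f n
  comm_ε : f 0 ≫ R'.ε = R.ε ≫ k

namespace Hom

variable {R} {K' : 𝒜} {R' : Resolution K'} {k : K ⟶ K'} (φ : Hom R R' k)

/-- The map on cocycles induced by a morphism of resolutions. -/
def mapCocycles (F : 𝒜) (n : ℕ) : R'.cocycles F n →+ R.cocycles F n :=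
  ((Preadditive.leftComp F (φ.f n)).comp (R'.cocycles F n).subtype).codRestrict
    (R.cocycles F n) fun a ↦ by
      have h : R'.d n ≫ a.1 = 0 := a.2
      change R.d n ≫ φ.f n ≫ a.1 = 0
      rw [← reassoc_of% φ.comm, h, comp_zero]

lemma mapCocycles_mem_coboundaries (F : 𝒜) (n : ℕ) (a : R'.cocycles F n)
    (ha : a.1 ∈ R'.coboundaries F n) : (φ.mapCocycles F n a).1 ∈ R.coboundaries F n := by
  obtain ⟨a, h⟩ := a
  cases n with
  | zero =>
    have h' : a = 0 := ha
    change φ.f 0 ≫ a = 0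
    rw [h', comp_zero]
  | succ n =>
    obtain ⟨b, rfl⟩ := ha
    refine ⟨φ.f n ≫ b, ?_⟩
    change R.d n ≫ φ.f n ≫ b = φ.f (n + 1) ≫ R'.d n ≫ b
    rw [← reassoc_of% φ.comm]

/-- The map on cohomology induced by a morphism of resolutions. -/
def mapCohomology (F : 𝒜) (n : ℕ) : R'.Cohomology F n →+ R.Cohomology F n :=
  QuotientAddGroup.map _ _ (φ.mapCocycles F n) fun a ha ↦ φ.mapCocycles_mem_coboundaries F n a ha

/-- The morphism of shifted resolutions. -/
def shift : Hom R.shift R'.shift (kernel.map R.ε R'.ε (φ.f 0) k φ.comm_ε.symm) where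
  f n := φ.f (n + 1)
  comm n := φ.comm (n + 1)
  comm_ε := by
    rw [← cancel_mono (kernel.ι R'.ε)]
    simp [Resolution.shift, φ.comm]

end Hom

variable [HasExt.{w} 𝒜]

/-- The homomorphism which sends an `n`-cocycle `a : X n ⟶ F` of `Hom(X •, F)` to its class in
`Extⁿ(K, F)`: the cocycle `a` factors through the image `Z` of `X n ⟶ X (n - 1)`, and its class is
the Yoneda product of the class in `Extⁿ(K, Z)` of the exact sequence
`0 ⟶ Z ⟶ X (n - 1) ⟶ ⋯ ⟶ X 0 ⟶ K ⟶ 0` with the morphism `Z ⟶ F` given by `a`. This is the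
dimension-shifting homomorphism. In degree zero it is the identification of a
cocycle with a morphism `K ⟶ F`, and it commutes with the connecting homomorphisms in `F`. -/
def classHom : ∀ {K : 𝒜} (R : Resolution K) (F : 𝒜) (n : ℕ), R.cocycles F n →+ Ext.{w} K F n
  | _, R, F, 0 =>
    AddMonoidHom.mk' (fun a ↦ Ext.mk₀ (R.desc₀ F a)) (fun a b ↦ by
      rw [← Ext.mk₀_add]
      congr 1
      have := R.epi
      rw [← cancel_epi R.ε, ε_desc₀, Preadditive.comp_add, ε_desc₀, ε_desc₀]
      rfl)
  | _, R, F, n + 1 =>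
    (R.head_shortExact.extClass.precomp F (Nat.add_comm 1 n)).comp
      ((classHom R.shift F n).comp (R.shiftCocycles F n))

lemma classHom_zero (F : 𝒜) (a : R.cocycles F 0) :
    R.classHom F 0 a = Ext.mk₀ (R.desc₀ F a) := rfl

lemma classHom_succ (F : 𝒜) (n : ℕ) (a : R.cocycles F (n + 1)) :
    R.classHom F (n + 1) a =
      R.head_shortExact.extClass.comp (R.shift.classHom F n (R.shiftCocycles F n a))
        (Nat.add_comm 1 n) := rfl

lemma classHom_eq_zero (F : 𝒜) : ∀ (n : ℕ) {K : 𝒜} (R : Resolution K) (a : R.cocycles F n),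
    a.1 ∈ R.coboundaries F n → R.classHom F n a = 0
  | 0, _, R, a, ha => by
    have : a = 0 := Subtype.ext ha
    rw [this, map_zero]
  | 1, _, R, a, ha => by
    obtain ⟨h, hh⟩ := ha
    have e : R.shift.desc₀ F (R.shiftCocycles F 0 a) = kernel.ι R.ε ≫ h := by
      have := R.shift.epi
      rw [← cancel_epi R.shift.ε, ε_desc₀]
      change _ = kernel.lift R.ε (R.d 0) R.d_ε ≫ kernel.ι R.ε ≫ h
      rw [kernel.lift_ι_assoc]
      exact hh.symm
    rw [classHom_succ, classHom_zero, e, ← Ext.mk₀_comp_mk₀]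
    exact R.head_shortExact.extClass_comp_assoc (Ext.mk₀ h)
  | n + 2, _, R, a, ha => by
    rw [classHom_succ, classHom_eq_zero F (n + 1) R.shift (R.shiftCocycles F (n + 1) a) ha, Ext.comp_zero]

/-- The homomorphism `Hⁿ(Hom(X •, F)) ⟶ Extⁿ(K, F)`. -/
def toExt (F : 𝒜) (n : ℕ) : R.Cohomology F n →+ Ext.{w} K F n :=
  QuotientAddGroup.lift _ (R.classHom F n) fun a ha ↦ R.classHom_eq_zero F n a ha

/-- The map on cohomology induced by a morphism of coefficients. -/
def mapCoeff {F G : 𝒜} (φ : F ⟶ G) (n : ℕ) : R.Cohomology F n →+ R.Cohomology G n :=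
  QuotientAddGroup.map _ _
    (((Preadditive.rightComp (R.X n) φ).comp (R.cocycles F n).subtype).codRestrict
      (R.cocycles G n) fun a ↦ by
        have h : R.d n ≫ a.1 = 0 := a.2
        change R.d n ≫ a.1 ≫ φ = 0
        rw [reassoc_of% h, zero_comp]) (by
    rintro ⟨a, ha⟩ h
    cases n with
    | zero =>
      have h' : a = 0 := h
      change a ≫ φ = 0
      rw [h', zero_comp]
    | succ n =>
      obtain ⟨b, rfl⟩ := h
      exact ⟨b ≫ φ, (Category.assoc _ _ _).symm⟩)

namespace Hom

variable {R} {K' : 𝒜} {R' : Resolution K'} {k : K ⟶ K'} (φ : Hom R R' k)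

lemma classHom_mapCocycles (F : 𝒜) : ∀ (n : ℕ) {K K' : 𝒜} {R : Resolution K} {R' : Resolution K'}
    {k : K ⟶ K'} (φ : Hom R R' k) (a : R'.cocycles F n),
    R.classHom F n (φ.mapCocycles F n a) = (Ext.mk₀ k).comp (R'.classHom F n a) (zero_add n)
  | 0, _, _, R, R', k, φ, a => by
    rw [classHom_zero, classHom_zero, Ext.mk₀_comp_mk₀]
    congr 1
    have := R.epi
    rw [← cancel_epi R.ε, ε_desc₀, ← reassoc_of% φ.comm_ε, ε_desc₀]
    rfl
  | n + 1, _, _, R, R', k, φ, a => by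
    have h := ShortComplex.ShortExact.extClass_naturality R.head_shortExact R'.head_shortExact
      { τ₁ := kernel.map R.ε R'.ε (φ.f 0) k φ.comm_ε.symm, τ₂ := φ.f 0, τ₃ := k,
        comm₁₂ := by simp, comm₂₃ := φ.comm_ε }
    rw [classHom_succ, classHom_succ]
    change R.head_shortExact.extClass.comp
      (R.shift.classHom F n (φ.shift.mapCocycles F n (R'.shiftCocycles F n a)))
        (Nat.add_comm 1 n) = _
    rw [classHom_mapCocycles F n φ.shift (R'.shiftCocycles F n a),
      ← Ext.comp_assoc (a₁₂ := 1) _ _ _ (by lia) (by lia) (by lia),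
      ← Ext.comp_assoc (a₁₂ := 1) _ _ _ (by lia) (by lia) (by lia)]
    exact congrArg (fun z ↦ Ext.comp z _ _) h

lemma toExt_mapCohomology (F : 𝒜) (n : ℕ) (x : R'.Cohomology F n) :
    R.toExt F n (φ.mapCohomology F n x) = (Ext.mk₀ k).comp (R'.toExt F n x) (zero_add n) := by
  obtain ⟨a, rfl⟩ := QuotientAddGroup.mk_surjective x
  exact classHom_mapCocycles F n φ a

end Hom

end Resolution

end Resolutions

section DerivedCup

variable {𝒜 : Type u} [Category.{v} 𝒜] [Abelian 𝒜]

section Flat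

variable [MonoidalCategory 𝒜]

/-- An object `M` of a monoidal abelian category is flat if the functors `M ⊗ -` and `- ⊗ M` are
exact. -/
class FlatObject (M : 𝒜) : Prop where
  left_lim : PreservesFiniteLimits (tensorLeft M)
  left_colim : PreservesFiniteColimits (tensorLeft M)
  right_lim : PreservesFiniteLimits (tensorRight M)
  right_colim : PreservesFiniteColimits (tensorRight M)

attribute [instance] FlatObject.left_lim FlatObject.left_colim FlatObject.right_lim
  FlatObject.right_colim

instance (M : 𝒜) [FlatObject M] : (tensorLeft M).Additive :=
  have := preservesBinaryBiproducts_of_preservesBinaryProducts (tensorLeft M)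
  Functor.additive_of_preservesBinaryBiproducts _

instance (M : 𝒜) [FlatObject M] : (tensorRight M).Additive :=
  have := preservesBinaryBiproducts_of_preservesBinaryProducts (tensorRight M)
  Functor.additive_of_preservesBinaryBiproducts _

end Flat

/-- An object `M` is torsion free if the multiplication by every non-zero integer is a
monomorphism `M ⟶ M`. -/
def TorsionFree (M : 𝒜) : Prop := ∀ n : ℤ, n ≠ 0 → Mono (n • 𝟙 M)

lemma TorsionFree.of_mono {M N : 𝒜} (hM : TorsionFree M) (i : N ⟶ M) [Mono i] :
    TorsionFree N := fun n hn ↦ by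
  have := hM n hn
  have h : (n • 𝟙 N) ≫ i = i ≫ (n • 𝟙 M) := by simp
  have : Mono ((n • 𝟙 N) ≫ i) := by rw [h]; infer_instance
  exact mono_of_mono _ i

variable [HasExt.{w} 𝒜]

lemma exists_epi_comp_eq_zero [EnoughInjectives 𝒜] : ∀ (s : ℕ) {L B : 𝒜} (y : Ext.{w} L B (s + 1)),
    ∃ (E : 𝒜) (p : E ⟶ L), Epi p ∧ (Ext.mk₀ p).comp y (zero_add _) = 0
  | s, L, B, y => by
    let S : ShortComplex 𝒜 := ShortComplex.mk (Injective.ι B) (cokernel.π (Injective.ι B))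
      (cokernel.condition _)
    have hS : S.ShortExact := { exact := ShortComplex.exact_cokernel _ }
    obtain ⟨y', hy'⟩ := Ext.covariant_sequence_exact₁ L hS y (Ext.eq_zero_of_injective _)
      (n₀ := s) rfl
    have key : ∃ (E : 𝒜) (p : E ⟶ L), Epi p ∧
        ((Ext.mk₀ p).comp y' (zero_add _)).comp hS.extClass (rfl : s + 1 = s + 1) = 0 := by
      cases s with
      | zero =>
        obtain ⟨f, rfl⟩ := (Ext.mk₀_bijective _ _).2 y'
        refine ⟨pullback f S.g, pullback.fst _ _, inferInstance, ?_⟩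
        rw [Ext.mk₀_comp_mk₀, pullback.condition, ← Ext.mk₀_comp_mk₀,
          Ext.comp_assoc (a₁₂ := 0) (a₂₃ := 1) _ _ _ (by lia) (by lia) (by lia),
          hS.comp_extClass, Ext.comp_zero]
      | succ s =>
        obtain ⟨E, p, hp, h⟩ := exists_epi_comp_eq_zero s y'
        exact ⟨E, p, hp, by rw [h, Ext.zero_comp]⟩
    obtain ⟨E, p, hp, h⟩ := key
    refine ⟨E, p, hp, ?_⟩
    rw [← hy', ← Ext.comp_assoc (a₁₂ := s) _ _ _ (by lia) (by lia) (by lia)]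
    exact h

variable [MonoidalCategory 𝒜]

/-- The class of monoidal abelian categories in which the flat objects behave as in the category of
abelian groups: torsion free objects are flat, and every object is a quotient of a
torsion free object. -/
class HasTorsionFreeCovers (𝒜 : Type u) [Category.{v} 𝒜] [Abelian 𝒜] [MonoidalCategory 𝒜] :
    Prop where
  flat (M : 𝒜) : TorsionFree M → FlatObject M
  cover (X : 𝒜) : ∃ (M : 𝒜) (p : M ⟶ X), TorsionFree M ∧ Epi p

/-- A factorization `L ⟶ M[s] ⟶ B[s]` of a class `y ∈ Extˢ(L, B)`, with `M` a flat
object. -/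
structure FlatFactorization {L B : 𝒜} {s : ℕ} (y : Ext.{w} L B s) where
  M : 𝒜
  flat : FlatObject M
  κ : Ext.{w} L M s
  g : M ⟶ B
  fac : κ.comp (Ext.mk₀ g) (add_zero s) = y

lemma exists_flatFactorization [EnoughInjectives 𝒜] [HasTorsionFreeCovers 𝒜] {B : 𝒜} :
    ∀ (s : ℕ) {L : 𝒜} (_ : TorsionFree L) (y : Ext.{w} L B s), Nonempty (FlatFactorization y)
  | 0, L, hL, y => by
    obtain ⟨f, rfl⟩ := (Ext.mk₀_bijective _ _).2 y
    exact ⟨{ M := L, flat := HasTorsionFreeCovers.flat L hL, κ := Ext.mk₀ (𝟙 L), g := f,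
             fac := by simp }⟩
  | s + 1, L, hL, y => by
    obtain ⟨E, p, hp, h⟩ := exists_epi_comp_eq_zero s y
    obtain ⟨P, q, hP, hq⟩ := HasTorsionFreeCovers.cover E
    have : Epi (q ≫ p) := epi_comp _ _
    let S : ShortComplex 𝒜 := ShortComplex.mk (kernel.ι (q ≫ p)) (q ≫ p) (kernel.condition _)
    have hS : S.ShortExact := { exact := ShortComplex.exact_kernel _ }
    obtain ⟨x, rfl⟩ := Ext.contravariant_sequence_exact₃ hS B y (by
      change (Ext.mk₀ (q ≫ p)).comp y _ = 0
      rw [← Ext.mk₀_comp_mk₀, Ext.comp_assoc (a₁₂ := 0) (a₂₃ := s + 1) _ _ _ (by lia) (by lia)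
        (by lia), h, Ext.comp_zero]) (Nat.add_comm 1 s)
    obtain ⟨F⟩ := exists_flatFactorization s (hP.of_mono (kernel.ι (q ≫ p))) x
    exact ⟨{ M := F.M, flat := F.flat, κ := hS.extClass.comp F.κ (Nat.add_comm 1 s), g := F.g,
             fac := by
              rw [Ext.comp_assoc (a₁₂ := s + 1) (a₂₃ := s) _ _ _ (by lia) (by lia) (by lia),
                F.fac] }⟩

/-- Given flat objects `K` and `L`, classes `x ∈ Extʳ(K, A)` and `y ∈ Extˢ(L, B)`, and a
factorization `L ⟶ M[s] ⟶ B[s]` of `y` through a flat object `M`, this is the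
derived tensor product of the morphisms `x : K ⟶ A[r]` and `y : L ⟶ B[s]`, followed by the
canonical morphism from the derived to the ordinary tensor product, i.e. the composition
`K ⊗ L ⟶ (K ⊗ M)[s] ⟶ (A ⊗ M)[r + s] ⟶ (A ⊗ B)[r + s]`.
As `K` and `M` are flat, the first two morphisms are obtained by applying the exact functors
`K ⊗ -` and `- ⊗ M`. -/
def FlatFactorization.tensor {K L A B : 𝒜} [FlatObject K] {r s : ℕ} (x : Ext.{w} K A r)
    {y : Ext.{w} L B s} (F : FlatFactorization y) : Ext.{w} (K ⊗ L) (A ⊗ B) (r + s) :=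
  have := F.flat
  (((F.κ.mapExactFunctor (tensorLeft K)).comp (x.mapExactFunctor (tensorRight F.M))
    (Nat.add_comm s r)).comp (Ext.mk₀ (A ◁ F.g)) (add_zero (r + s)) :)

/-- The derived tensor product of classes `x ∈ Extʳ(K, A)` and `y ∈ Extˢ(L, B)`, for torsion free
objects `K` and `L`, followed by the canonical morphism from the derived tensor
product of `A` and `B` to `A ⊗ B`. It does not depend on the factorization of `y` which is used. -/
def derivedTensor [EnoughInjectives 𝒜] [HasTorsionFreeCovers 𝒜] {K L A B : 𝒜}
    (hK : TorsionFree K) (hL : TorsionFree L) {r s : ℕ} (x : Ext.{w} K A r) (y : Ext.{w} L B s) :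
    Ext.{w} (K ⊗ L) (A ⊗ B) (r + s) :=
  have := HasTorsionFreeCovers.flat K hK
  (exists_flatFactorization s hL y).some.tensor x

end DerivedCup

section AbelianSheaves

/-- The category of abelian groups in the universe `u`, realized as the category of modules over
(a copy in the universe `u` of) the ring `ℤ`. -/
abbrev Ab := ModuleCat.{u} (ULift.{u} ℤ)

instance : IsDomain (ULift.{u} ℤ) := (ULift.ringEquiv (R := ℤ)).toMulEquiv.isDomain ℤ

instance : IsPrincipalIdealRing (ULift.{u} ℤ) :=
  IsPrincipalIdealRing.of_surjective (ULift.ringEquiv (R := ℤ)).symm.toRingHom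
    (ULift.ringEquiv (R := ℤ)).symm.surjective

variable {C : Type u} [SmallCategory C]

instance : EnoughInjectives (Cᵒᵖ ⥤ Ab.{u}) :=
  EnoughInjectives.of_equivalence (sheafBotEquivalence Ab.{u}).inverse

instance : HasExt.{u} (Cᵒᵖ ⥤ Ab.{u}) := hasExt_of_enoughInjectives _

instance (P : Cᵒᵖ ⥤ Ab.{u}) : PreservesColimits (tensorLeft P) where
  preservesColimitsOfShape := ⟨fun {K} ↦ by
    apply preservesColimit_of_evaluation
    intro V
    exact inferInstanceAs (PreservesColimit K ((evaluation _ _).obj V ⋙ tensorLeft (P.obj V)))⟩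

lemma ulift_smul {M : Type u} [AddCommGroup M] [m : Module (ULift.{u} ℤ) M] (n : ULift.{u} ℤ)
    (x : M) : @HSMul.hSMul _ _ _ (@instHSMul _ _ m.toSMul) n x = n.down • x := by
  obtain ⟨n⟩ := n
  have h : (ULift.up n : ULift.{u} ℤ) = ((n : ℤ) : ULift.{u} ℤ) := by ext; simp
  rw [h]
  exact Int.cast_smul_eq_zsmul (ULift.{u} ℤ) n x

/-- Torsion free presheaves consist of torsion free groups. -/
lemma torsionFree_presheaf_iff (P : Cᵒᵖ ⥤ Ab.{u}) :
    TorsionFree P ↔ ∀ V, @Module.IsTorsionFree (ULift.{u} ℤ) (P.obj V) _ _ (P.obj V).isModule := by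
  have key (n : ℤ) : Mono (n • 𝟙 P) ↔ ∀ V, Function.Injective (fun x : P.obj V ↦ n • x) := by
    rw [NatTrans.mono_iff_mono_app]
    refine forall_congr' fun V ↦ ?_
    rw [ModuleCat.mono_iff_injective]
    have : ⇑((n • 𝟙 P : P ⟶ P).app V) = (fun x : P.obj V ↦ n • x) :=
      funext fun x ↦ by rw [NatTrans.app_zsmul]; rfl
    exact iff_of_eq (congrArg Function.Injective this)
  constructor
  · intro h V
    refine ⟨fun n hn ↦ ?_⟩
    have hn' : n.down ≠ 0 := fun h0 ↦ hn.ne_zero (ULift.ext _ _ h0)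
    have := (key n.down).1 (h n.down hn') V
    intro x y hxy
    exact this ((ulift_smul n x).symm.trans (hxy.trans (ulift_smul n y)))
  · intro h n hn
    rw [key]
    intro V x y hxy
    have hn' : IsRegular (ULift.up n : ULift.{u} ℤ) :=
      IsRegular.of_ne_zero fun h0 ↦ hn (congrArg ULift.down h0)
    exact (h V).isSMulRegular hn'
      ((ulift_smul ⟨n⟩ x).trans (hxy.trans (ulift_smul ⟨n⟩ y).symm))

lemma flat_of_torsionFree_presheaf (P : Cᵒᵖ ⥤ Ab.{u}) (hP : TorsionFree P) : FlatObject P := by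
  have hP' := (torsionFree_presheaf_iff P).1 hP
  have h₁ : PreservesFiniteColimits (tensorLeft P) := inferInstance
  have : (tensorLeft P).Additive :=
    have := preservesBinaryBiproducts_of_preservesBinaryCoproducts (tensorLeft P)
    Functor.additive_of_preservesBinaryBiproducts _
  have h₂ : PreservesFiniteLimits (tensorLeft P) := by
    rw [Functor.preservesFiniteLimits_iff_forall_exact_map_and_mono]
    intro S hS
    have h₃ : ∀ S : ShortComplex (Cᵒᵖ ⥤ Ab.{u}), S.ShortExact →
        (S.map (tensorLeft P)).Exact ∧ Epi ((tensorLeft P).map S.g) :=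
      ((tensorLeft P).preservesFiniteColimits_tfae.out 3 0).1 h₁
    refine ⟨(h₃ S hS).1, ?_⟩
    rw [NatTrans.mono_iff_mono_app]
    intro V
    have := hS.mono_f
    have hf : Function.Injective (S.f.app V) :=
      (ModuleCat.mono_iff_injective _).1 inferInstance
    rw [ModuleCat.mono_iff_injective]
    exact Module.Flat.lTensor_preserves_injective_linearMap (M := P.obj V) (S.f.app V).hom hf
  let e : tensorLeft P ≅ tensorRight P := BraidedCategory.tensorLeftIsoTensorRight P
  exact ⟨h₂, h₁, preservesFiniteLimits_of_natIso e, preservesFiniteColimits_of_natIso e⟩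

/-- The free presheaf of abelian groups on a presheaf of sets. -/
def free : (Cᵒᵖ ⥤ Type u) ⥤ (Cᵒᵖ ⥤ Ab.{u}) :=
  (Functor.whiskeringRight _ _ _).obj (ModuleCat.free (ULift.{u} ℤ))

lemma torsionFree_free (X : Cᵒᵖ ⥤ Type u) : TorsionFree (free.obj X) :=
  (torsionFree_presheaf_iff _).2 fun V ↦
    inferInstanceAs (Module.IsTorsionFree (ULift.{u} ℤ) (X.obj V →₀ ULift.{u} ℤ))

/-- The generator of `ℤ[X](V)` given by `x ∈ X(V)`. -/
abbrev gen {X : Cᵒᵖ ⥤ Type u} {V : Cᵒᵖ} (x : X.obj V) : (free.obj X).obj V :=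
  ModuleCat.freeMk x

lemma free_map_gen {X Y : Cᵒᵖ ⥤ Type u} (f : X ⟶ Y) {V : Cᵒᵖ} (x : X.obj V) :
    (free.map f).app V (gen x) = gen (f.app V x) := ModuleCat.free_map_apply _ _

lemma free_hom_ext {X : Cᵒᵖ ⥤ Type u} {P : Cᵒᵖ ⥤ Ab.{u}} {f g : free.obj X ⟶ P}
    (h : ∀ (V : Cᵒᵖ) (x : X.obj V), f.app V (gen x) = g.app V (gen x)) : f = g := by
  ext V : 2
  exact ModuleCat.free_hom_ext fun x ↦ h V x

instance : HasTorsionFreeCovers (Cᵒᵖ ⥤ Ab.{u}) where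
  flat := flat_of_torsionFree_presheaf
  cover P := by
    let p : free.obj (P ⋙ forget _) ⟶ P :=
      ((ModuleCat.adj (ULift.{u} ℤ)).whiskerRight Cᵒᵖ).counit.app P
    refine ⟨_, p, torsionFree_free _, (NatTrans.epi_iff_epi_app p).2 fun V ↦ ?_⟩
    exact inferInstanceAs (Epi ((ModuleCat.adj (ULift.{u} ℤ)).counit.app (P.obj V)))

/-- The homomorphism `ℤ[X(V)] ⟶ ℤ[X(V)] ⊗ ℤ[X(V)]` which sends a generator `x` to `x ⊗ x`. -/
def diagApp (X : Cᵒᵖ ⥤ Type u) (V : Cᵒᵖ) :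
    (free.obj X).obj V ⟶ ((free.obj X).obj V) ⊗ ((free.obj X).obj V) :=
  ModuleCat.freeDesc (TypeCat.ofHom fun x ↦ gen (X := X) (V := V) x ⊗ₜ gen (X := X) (V := V) x)

lemma diagApp_gen {X : Cᵒᵖ ⥤ Type u} {V : Cᵒᵖ} (x : X.obj V) :
    diagApp X V (gen x) = gen x ⊗ₜ gen x := ModuleCat.freeDesc_apply _ _

/-- The homomorphism `ℤ[X] ⟶ ℤ[X] ⊗ ℤ[X]` which sends a generator `x` to `x ⊗ x`. -/
def diag (X : Cᵒᵖ ⥤ Type u) : free.obj X ⟶ free.obj X ⊗ free.obj X where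
  app V := diagApp X V
  naturality V W f := by
    refine ModuleCat.free_hom_ext fun x ↦ ?_
    have h : (free.obj X).map f (gen x) = gen (X.map f x) := ModuleCat.free_map_apply _ _
    change diagApp X W ((free.obj X).map f (gen x)) =
      ((free.obj X).map f ⊗ₘ (free.obj X).map f) (diagApp X V (gen x))
    rw [h, diagApp_gen, diagApp_gen]
    change _ = (free.obj X).map f (gen x) ⊗ₜ (free.obj X).map f (gen x)
    rw [h]

lemma diag_gen {X : Cᵒᵖ ⥤ Type u} {V : Cᵒᵖ} (x : X.obj V) :
    (diag X).app V (gen x) = gen x ⊗ₜ gen x := diagApp_gen x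

section Sheaves

variable (J : GrothendieckTopology C)

instance : HasExt.{u} (Sheaf J Ab.{u}) := hasExt_of_enoughInjectives _

set_option synthInstance.maxHeartbeats 400000 in
instance : (J.W (A := Ab.{u})).IsMonoidal := GrothendieckTopology.W.monoidal

instance : MonoidalCategory (Sheaf J Ab.{u}) := Sheaf.monoidalCategory J _

instance : SymmetricCategory (Sheaf J Ab.{u}) := Sheaf.symmetricCategory J _

instance : (presheafToSheaf J Ab.{u}).Monoidal := inferInstance

end Sheaves

end AbelianSheaves

section Cech

variable {C : Type u} [SmallCategory C]

lemma presheaf_exact_of_sections (S : ShortComplex (Cᵒᵖ ⥤ Ab.{u}))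
    (h : ∀ (V : Cᵒᵖ) (x : S.X₂.obj V), S.g.app V x = 0 → ∃ y, S.f.app V y = x) : S.Exact := by
  rw [ShortComplex.exact_iff_isZero_homology, Functor.isZero_iff]
  intro V
  have e := S.mapHomologyIso ((evaluation Cᵒᵖ Ab.{u}).obj V)
  refine IsZero.of_iso ?_ e.symm
  rw [← ShortComplex.exact_iff_isZero_homology, ShortComplex.moduleCat_exact_iff]
  exact h V

variable {U : C} (E : PreZeroHypercover.{u} U)

/-- The sections over `V` of the `n`-th term of the Čech nerve of a family `f i : X i ⟶ U`: the
tuples of `n + 1` morphisms from `V` to members of the family with the same composite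
`V ⟶ U`. -/
def NerveSections (n : ℕ) (V : C) : Type u :=
  { x : Fin (n + 1) → Σ i : E.I₀, (V ⟶ E.X i) //
    ∀ k l, (x k).2 ≫ E.f (x k).1 = (x l).2 ≫ E.f (x l).1 }

/-- The `n`-th term of the Čech nerve of a family `f i : X i ⟶ U`, as a presheaf of sets. If the
fibre products exist in `C`, it is the disjoint union, over all `(i₀, …, iₙ)`, of the presheaves
represented by the fibre products `X i₀ ×_U ⋯ ×_U X iₙ`. -/
def nerve (n : ℕ) : Cᵒᵖ ⥤ Type u where
  obj V := NerveSections E n V.unop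
  map f := TypeCat.ofHom fun x ↦ ⟨fun k ↦ ⟨(x.1 k).1, f.unop ≫ (x.1 k).2⟩, fun k l ↦ by
    simp only [Category.assoc, x.2 k l]⟩
  map_id V := by
    ext x
    exact Subtype.ext (funext fun k ↦ Sigma.ext rfl (heq_of_eq (Category.id_comp _)))
  map_comp f g := by
    ext x
    exact Subtype.ext (funext fun k ↦ Sigma.ext rfl (heq_of_eq (Category.assoc _ _ _)))

/-- The morphism `(x₀, …, xₙ) ↦ (x_{φ 0}, …, x_{φ m})`. -/
def reindex {m n : ℕ} (φ : Fin (m + 1) → Fin (n + 1)) : nerve E n ⟶ nerve E m where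
  app _ := TypeCat.ofHom fun x ↦ ⟨fun k ↦ x.1 (φ k), fun _ _ ↦ x.2 _ _⟩
  naturality _ _ _ := rfl

lemma sieve_mem {E : PreZeroHypercover.{u} U} {V : C} (y : Σ i : E.I₀, (V ⟶ E.X i)) :
    E.sieve₀ (y.2 ≫ E.f y.1) := E.sieve₀.downward_closed (E.sieve₀_f _) _

/-- The augmentation of the Čech nerve, with values in the sieve generated by the family. -/
def nerveAug : nerve E 0 ⟶ E.sieve₀.functor where
  app V := TypeCat.ofHom fun x ↦ ⟨(x.1 0).2 ≫ E.f (x.1 0).1,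
    sieve_mem _⟩
  naturality V W f := by
    ext x
    exact Subtype.ext (Category.assoc _ _ _)

/-- The boundary `ℤ[N_{n+1}] ⟶ ℤ[N_n]`, the alternating sum of the face maps. -/
def cechD (n : ℕ) : free.obj (nerve E (n + 1)) ⟶ free.obj (nerve E n) :=
  ∑ i : Fin (n + 2), (-1 : ℤ) ^ (i : ℕ) • free.map (reindex E i.succAbove)

/-- The augmentation `ℤ[N_0] ⟶ ℤ[S]`, where `S` is the sieve generated by the family. -/
def cechε : free.obj (nerve E 0) ⟶ free.obj E.sieve₀.functor := free.map (nerveAug E)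

variable {E}

lemma reindex_app {m n : ℕ} (φ : Fin (m + 1) → Fin (n + 1)) {V : Cᵒᵖ} (x : (nerve E n).obj V) :
    ((reindex E φ).app V x).1 = x.1 ∘ φ := rfl

lemma presheaf_add_app {P Q : Cᵒᵖ ⥤ Ab.{u}} (f g : P ⟶ Q) {V : Cᵒᵖ} (x : P.obj V) :
    (f + g).app V x = f.app V x + g.app V x := rfl

lemma presheaf_zsmul_app {P Q : Cᵒᵖ ⥤ Ab.{u}} (n : ℤ) (f : P ⟶ Q) {V : Cᵒᵖ} (x : P.obj V) :
    (n • f).app V x = n • f.app V x := by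
  rw [NatTrans.app_zsmul]
  rfl

lemma presheaf_sum_app {P Q : Cᵒᵖ ⥤ Ab.{u}} {ι : Type*} (s : Finset ι) (f : ι → (P ⟶ Q)) {V : Cᵒᵖ}
    (x : P.obj V) : (∑ i ∈ s, f i).app V x = ∑ i ∈ s, (f i).app V x := by
  let φ : (P ⟶ Q) →+ Q.obj V := AddMonoidHom.mk' (fun f ↦ f.app V x) fun _ _ ↦ rfl
  exact map_sum φ f s

lemma cechD_gen (n : ℕ) {V : Cᵒᵖ} (x : (nerve E (n + 1)).obj V) :
    (cechD E n).app V (gen x) =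
      ∑ i : Fin (n + 2), (-1 : ℤ) ^ (i : ℕ) • gen ((reindex E i.succAbove).app V x) := by
  rw [cechD, presheaf_sum_app]
  refine Finset.sum_congr rfl fun i _ ↦ ?_
  rw [presheaf_zsmul_app, free_map_gen]

lemma exists_lift {V : C} (f : V ⟶ U) (hf : E.sieve₀ f) :
    ∃ y : Σ i : E.I₀, (V ⟶ E.X i), y.2 ≫ E.f y.1 = f := by
  obtain ⟨W, g, h, ⟨i⟩, rfl⟩ := hf
  exact ⟨⟨i, g⟩, rfl⟩

/-- A chosen lift of an element of the sieve generated by the family. -/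
def lift {V : C} (f : V ⟶ U) (hf : E.sieve₀ f) : Σ i : E.I₀, (V ⟶ E.X i) :=
  (exists_lift f hf).choose

lemma lift_spec {V : C} (f : V ⟶ U) (hf : E.sieve₀ f) : (lift f hf).2 ≫ E.f (lift f hf).1 = f :=
  (exists_lift f hf).choose_spec

lemma lift_congr {V : C} (f g : V ⟶ U) (hf : E.sieve₀ f) (hg : E.sieve₀ g) (h : f = g) :
    lift f hf = lift g hg := by
  subst h
  rfl

/-- The tuple `(σ(f), x₀, …, xₙ)`, where `f` is the composite of `(x₀, …, xₙ)` and `σ(f)` is the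
chosen lift of `f`. -/
def cone (n : ℕ) {V : Cᵒᵖ} (x : (nerve E n).obj V) : (nerve E (n + 1)).obj V :=
  have hx : E.sieve₀ ((x.1 0).2 ≫ E.f (x.1 0).1) := sieve_mem _
  ⟨Fin.cons (lift _ hx) x.1, by
    have key : ∀ k : Fin (n + 1 + 1),
        ((Fin.cons (lift _ hx) x.1 : Fin (n + 1 + 1) → Σ i : E.I₀, (V.unop ⟶ E.X i)) k).2 ≫ E.f
          ((Fin.cons (lift _ hx) x.1 : Fin (n + 1 + 1) → Σ i : E.I₀, (V.unop ⟶ E.X i)) k).1 =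
          (x.1 0).2 ≫ E.f (x.1 0).1 := by
      intro k
      induction k using Fin.cases with
      | zero => exact lift_spec _ hx
      | succ k => exact x.2 _ _
    intro k l
    rw [key, key]⟩

lemma reindex_zero_cone (n : ℕ) {V : Cᵒᵖ} (x : (nerve E n).obj V) :
    (reindex E (Fin.succAbove 0)).app V (cone n x) = x :=
  Subtype.ext (funext fun _ ↦ rfl)

lemma reindex_succ_cone (n : ℕ) {V : Cᵒᵖ} (x : (nerve E (n + 1)).obj V) (i : Fin (n + 2)) :
    (reindex E i.succ.succAbove).app V (cone (n + 1) x) =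
      cone n ((reindex E i.succAbove).app V x) := by
  have hx : (x.1 0).2 ≫ E.f (x.1 0).1 =
      (((reindex E i.succAbove).app V x).1 0).2 ≫
        E.f (((reindex E i.succAbove).app V x).1 0).1 := x.2 _ _
  refine Subtype.ext (funext fun k ↦ ?_)
  induction k using Fin.cases with
  | zero =>
    exact lift_congr _ _ (sieve_mem _) (sieve_mem _) hx
  | succ k =>
    change (Fin.cons _ x.1 : Fin (n + 1 + 1 + 1) → _) (i.succ.succAbove k.succ) = _
    rw [Fin.succ_succAbove_succ]
    rfl

/-- The contracting homotopy. -/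
def coneHom (n : ℕ) (V : Cᵒᵖ) :
    (free.obj (nerve E n)).obj V ⟶ (free.obj (nerve E (n + 1))).obj V :=
  ModuleCat.freeDesc (TypeCat.ofHom fun x ↦ gen (V := V) (cone n x))

lemma coneHom_gen (n : ℕ) {V : Cᵒᵖ} (x : (nerve E n).obj V) :
    coneHom n V (gen x) = gen (cone n x) := ModuleCat.freeDesc_apply _ _

lemma cechD_coneHom (n : ℕ) (V : Cᵒᵖ) (x : (free.obj (nerve E (n + 1))).obj V) :
    (cechD E (n + 1)).app V (coneHom (n + 1) V x) +
      coneHom n V ((cechD E n).app V x) = x := by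
  have : coneHom (n + 1) V ≫ (cechD E (n + 1)).app V + (cechD E n).app V ≫ coneHom n V = 𝟙 _ := by
    refine ModuleCat.free_hom_ext fun x ↦ ?_
    change (cechD E (n + 1)).app V (coneHom (n + 1) V (gen x)) +
      coneHom n V ((cechD E n).app V (gen x)) = gen x
    rw [coneHom_gen, cechD_gen, cechD_gen, Fin.sum_univ_succ, map_sum]
    rw [reindex_zero_cone, Fin.val_zero, pow_zero, one_smul, add_assoc, ← Finset.sum_add_distrib]
    rw [Finset.sum_eq_zero, add_zero]
    intro i _
    rw [map_zsmul, coneHom_gen, reindex_succ_cone, Fin.val_succ, pow_succ]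
    simp
  exact congrArg (fun f ↦ f.hom x) this

/-- The contracting homotopy in degree `-1`. -/
def coneAug {V : Cᵒᵖ} (f : E.sieve₀.functor.obj V) : (nerve E 0).obj V :=
  ⟨fun _ ↦ lift f.1 f.2, fun _ _ ↦ rfl⟩

lemma nerveAug_coneAug {V : Cᵒᵖ} (f : E.sieve₀.functor.obj V) :
    (nerveAug E).app V (coneAug f) = f := Subtype.ext (lift_spec f.1 f.2)

/-- The contracting homotopy in degree `-1`. -/
def coneAugHom (V : Cᵒᵖ) :
    (free.obj E.sieve₀.functor).obj V ⟶ (free.obj (nerve E 0)).obj V :=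
  ModuleCat.freeDesc (TypeCat.ofHom fun f ↦ gen (V := V) (coneAug f))

lemma coneAugHom_gen {V : Cᵒᵖ} (f : E.sieve₀.functor.obj V) :
    coneAugHom V (gen f) = gen (coneAug f) := ModuleCat.freeDesc_apply _ _

lemma cechε_gen {V : Cᵒᵖ} (x : (nerve E 0).obj V) :
    (cechε E).app V (gen x) = gen ((nerveAug E).app V x) := free_map_gen _ _

lemma cechε_coneAugHom (V : Cᵒᵖ) (x : (free.obj E.sieve₀.functor).obj V) :
    (cechε E).app V (coneAugHom V x) = x := by
  have : coneAugHom V ≫ (cechε E).app V = 𝟙 _ := by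
    refine ModuleCat.free_hom_ext fun x ↦ ?_
    change (cechε E).app V (coneAugHom V (gen x)) = gen x
    rw [coneAugHom_gen, cechε_gen, nerveAug_coneAug]
  exact congrArg (fun f ↦ f.hom x) this

lemma reindex_one_cone {V : Cᵒᵖ} (x : (nerve E 0).obj V) :
    (reindex E (Fin.succAbove 1)).app V (cone 0 x) = coneAug ((nerveAug E).app V x) :=
  Subtype.ext (funext fun k ↦ by
    obtain rfl := Fin.fin_one_eq_zero k
    rfl)

lemma cechD_coneHom_zero (V : Cᵒᵖ) (x : (free.obj (nerve E 0)).obj V) :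
    (cechD E 0).app V (coneHom 0 V x) + coneAugHom V ((cechε E).app V x) = x := by
  have : coneHom 0 V ≫ (cechD E 0).app V + (cechε E).app V ≫ coneAugHom V = 𝟙 _ := by
    refine ModuleCat.free_hom_ext fun x ↦ ?_
    change (cechD E 0).app V (coneHom 0 V (gen x)) + coneAugHom V ((cechε E).app V (gen x)) = gen x
    rw [coneHom_gen, cechD_gen, cechε_gen, coneAugHom_gen, Fin.sum_univ_two, reindex_zero_cone,
      reindex_one_cone]
    simp
  exact congrArg (fun f ↦ f.hom x) this

variable (E)

lemma cechD_cechε : cechD E 0 ≫ cechε E = 0 := by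
  refine free_hom_ext fun V x ↦ ?_
  change (cechε E).app V ((cechD E 0).app V (gen x)) = 0
  rw [cechD_gen, Fin.sum_univ_two, map_add, map_zsmul, map_zsmul, cechε_gen, cechε_gen]
  have : (nerveAug E).app V ((reindex E (Fin.succAbove 0)).app V x) =
      (nerveAug E).app V ((reindex E (Fin.succAbove 1)).app V x) := Subtype.ext (x.2 _ _)
  rw [this]
  simp

/-- The Čech nerve as a simplicial presheaf. -/
def simplicialNerve : SimplicialObject (Cᵒᵖ ⥤ Type u) where
  obj Δ := nerve E Δ.unop.len
  map φ := reindex E φ.unop.toOrderHom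
  map_id _ := rfl
  map_comp _ _ := rfl

lemma cechD_cechD (n : ℕ) : cechD E (n + 1) ≫ cechD E n = 0 :=
  AlgebraicTopology.AlternatingFaceMapComplex.d_squared
    (((SimplicialObject.whiskering _ _).obj free).obj (simplicialNerve E)) n

/-- The Čech resolution `⋯ ⟶ ℤ[N_1] ⟶ ℤ[N_0] ⟶ ℤ[S]` of a family of morphisms with target `U`
which generates the sieve `S`. For a presheaf `P`, the cochain complex `Hom(ℤ[N_•], P)` is the
complex of Čech cochains with values in `P`. -/
def cechRes : Resolution (free.obj E.sieve₀.functor) where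
  X n := free.obj (nerve E n)
  d n := cechD E n
  ε := cechε E
  d_ε := cechD_cechε E
  d_d n := cechD_cechD E n
  epi := (NatTrans.epi_iff_epi_app _).2 fun V ↦ (ModuleCat.epi_iff_surjective _).2 fun x ↦
    ⟨coneAugHom V x, cechε_coneAugHom V x⟩
  exact₀ := presheaf_exact_of_sections _ fun V x hx ↦ ⟨coneHom 0 V x, by
    have h := cechD_coneHom_zero V x
    have hx' : (cechε E).app V x = 0 := hx
    rwa [hx', map_zero, add_zero] at h⟩
  exact_succ n := presheaf_exact_of_sections _ fun V x hx ↦ ⟨coneHom (n + 1) V x, by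
    have h := cechD_coneHom n V x
    have hx' : (cechD E n).app V x = 0 := hx
    rwa [hx', map_zero, add_zero] at h⟩

end Cech

section Cup

variable {C : Type u} [SmallCategory C] {U : C} {E : PreZeroHypercover.{u} U}
  {P Q : Cᵒᵖ ⥤ Ab.{u}}

/-- The morphism `(x₀, …, xₙ) ↦ (x₀, …, x_r)`, for `n = r + s`. -/
def front {r s n : ℕ} (h : r + s = n) : nerve E n ⟶ nerve E r :=
  reindex E fun k ↦ ⟨k.1, by lia⟩

/-- The morphism `(x₀, …, xₙ) ↦ (x_r, …, xₙ)`, for `n = r + s`. -/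
def back {r s n : ℕ} (h : r + s = n) : nerve E n ⟶ nerve E s :=
  reindex E fun k ↦ ⟨r + k.1, by lia⟩

/-- The Alexander–Whitney cup product of Čech cochains: it is given by
`(a ∪ b)(x₀, …, x_{r+s}) = a(x₀, …, x_r) ⊗ b(x_r, …, x_{r+s})`. -/
def cupCochain {r s n : ℕ} (h : r + s = n) (a : free.obj (nerve E r) ⟶ P)
    (b : free.obj (nerve E s) ⟶ Q) : free.obj (nerve E n) ⟶ P ⊗ Q :=
  diag (nerve E n) ≫ ((free.map (front h) ≫ a) ⊗ₘ (free.map (back h) ≫ b))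

/-- The bilinear map `P(V) × Q(V) ⟶ (P ⊗ Q)(V)`. -/
def tmul (V : Cᵒᵖ) : P.obj V →+ Q.obj V →+ (P ⊗ Q : Cᵒᵖ ⥤ Ab.{u}).obj V :=
  AddMonoidHom.mk' (fun x ↦ AddMonoidHom.mk' (fun y ↦ x ⊗ₜ[ULift.{u} ℤ] y)
    (TensorProduct.tmul_add x)) fun x x' ↦ by
      ext y
      exact TensorProduct.add_tmul x x' y

lemma cupCochain_gen {r s n : ℕ} (h : r + s = n) (a : free.obj (nerve E r) ⟶ P)
    (b : free.obj (nerve E s) ⟶ Q) {V : Cᵒᵖ} (x : (nerve E n).obj V) :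
    (cupCochain h a b).app V (gen x) =
      tmul V (a.app V (gen ((front h).app V x))) (b.app V (gen ((back h).app V x))) := by
  change ((free.map (front h) ≫ a) ⊗ₘ (free.map (back h) ≫ b)).app V
    ((diag (nerve E n)).app V (gen x)) = _
  rw [diag_gen]
  change a.app V ((free.map (front h)).app V (gen x)) ⊗ₜ
    b.app V ((free.map (back h)).app V (gen x)) = _
  rw [free_map_gen, free_map_gen]
  rfl

lemma sum_fin_aux {M : Type*} [AddCommGroup M] {r s n : ℕ} (h : r + s = n) (L : Fin (n + 2) → M)
    (A : Fin (r + 2) → M) (B : Fin (s + 2) → M)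
    (hA : ∀ i : Fin (r + 1), L ⟨i.1, by lia⟩ = A i.castSucc)
    (hB : ∀ j : Fin (s + 1), L ⟨r + 1 + j.1, by lia⟩ = B j.succ)
    (h₀ : A (Fin.last _) + B 0 = 0) : ∑ i, L i = ∑ i, A i + ∑ j, B j := by
  have e : (r + 1) + (s + 1) = n + 2 := by lia
  rw [← (finCongr e).sum_comp L, Fin.sum_univ_add, Fin.sum_univ_castSucc A, Fin.sum_univ_succ B]
  have h₁ : ∑ i : Fin (r + 1), L (finCongr e (Fin.castAdd (s + 1) i)) =
      ∑ i : Fin (r + 1), A i.castSucc := Finset.sum_congr rfl fun i _ ↦ hA i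
  have h₂ : ∑ i : Fin (s + 1), L (finCongr e (Fin.natAdd (r + 1) i)) =
      ∑ i : Fin (s + 1), B i.succ := Finset.sum_congr rfl fun i _ ↦ hB i
  rw [h₁, h₂, add_assoc, ← add_assoc (A _), h₀, zero_add]

lemma cupCochain_add_left {r s n : ℕ} (h : r + s = n) (a a' : free.obj (nerve E r) ⟶ P)
    (b : free.obj (nerve E s) ⟶ Q) :
    cupCochain h (a + a') b = cupCochain h a b + cupCochain h a' b := by
  refine free_hom_ext fun V x ↦ ?_
  rw [presheaf_add_app, cupCochain_gen, cupCochain_gen, cupCochain_gen, presheaf_add_app,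
    map_add, AddMonoidHom.add_apply]

lemma cupCochain_add_right {r s n : ℕ} (h : r + s = n) (a : free.obj (nerve E r) ⟶ P)
    (b b' : free.obj (nerve E s) ⟶ Q) :
    cupCochain h a (b + b') = cupCochain h a b + cupCochain h a b' := by
  refine free_hom_ext fun V x ↦ ?_
  rw [presheaf_add_app, cupCochain_gen, cupCochain_gen, cupCochain_gen, presheaf_add_app,
    map_add]

lemma reindex_congr {m n : ℕ} {φ ψ : Fin (m + 1) → Fin (n + 1)} {V : Cᵒᵖ} (x : (nerve E n).obj V)
    (h : ∀ k, φ k = ψ k) : (reindex E φ).app V x = (reindex E ψ).app V x := by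
  obtain rfl : φ = ψ := funext h
  rfl

/-- The Leibniz rule for the cup product of Čech cochains. -/
lemma cechD_cupCochain {r s n : ℕ} (h : r + s = n) (a : free.obj (nerve E r) ⟶ P)
    (b : free.obj (nerve E s) ⟶ Q) :
    cechD E n ≫ cupCochain h a b =
      cupCochain (show (r + 1) + s = n + 1 by lia) (cechD E r ≫ a) b +
        (-1 : ℤ) ^ r • cupCochain (show r + (s + 1) = n + 1 by lia) a (cechD E s ≫ b) := by
  have hr : (r + 1) + s = n + 1 := by lia
  have hs : r + (s + 1) = n + 1 := by lia
  refine free_hom_ext fun V x ↦ ?_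
  have e₁ : (cechD E n ≫ cupCochain h a b).app V (gen x) =
      ∑ i : Fin (n + 2), (-1 : ℤ) ^ (i : ℕ) • tmul V
        (a.app V (gen ((front h).app V ((reindex E i.succAbove).app V x))))
        (b.app V (gen ((back h).app V ((reindex E i.succAbove).app V x)))) := by
    change (cupCochain h a b).app V ((cechD E n).app V (gen x)) = _
    rw [cechD_gen, map_sum]
    exact Finset.sum_congr rfl fun i _ ↦ by rw [map_zsmul, cupCochain_gen]
  have e₂ : (cechD E r ≫ a).app V (gen ((front hr).app V x)) =
      ∑ i : Fin (r + 2), (-1 : ℤ) ^ (i : ℕ) • a.app V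
        (gen ((reindex E i.succAbove).app V ((front hr).app V x))) := by
    change a.app V ((cechD E r).app V _) = _
    rw [cechD_gen, map_sum]
    exact Finset.sum_congr rfl fun i _ ↦ by rw [map_zsmul]
  have e₃ : (cechD E s ≫ b).app V (gen ((back hs).app V x)) =
      ∑ i : Fin (s + 2), (-1 : ℤ) ^ (i : ℕ) • b.app V
        (gen ((reindex E i.succAbove).app V ((back hs).app V x))) := by
    change b.app V ((cechD E s).app V _) = _
    rw [cechD_gen, map_sum]
    exact Finset.sum_congr rfl fun i _ ↦ by rw [map_zsmul]
  rw [presheaf_add_app, presheaf_zsmul_app, cupCochain_gen, cupCochain_gen, e₁, e₂, e₃]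
  simp only [map_sum, AddMonoidHom.finsetSum_apply, map_zsmul, AddMonoidHom.smul_apply,
    Finset.smul_sum, smul_smul]
  refine sum_fin_aux h _ _ _ (fun i ↦ ?_) (fun j ↦ ?_) ?_
  · have h₁ : (front h).app V ((reindex E (Fin.succAbove ⟨i.1, by lia⟩)).app V x) =
        (reindex E i.castSucc.succAbove).app V ((front hr).app V x) :=
      reindex_congr x (fun k ↦ by
        simp only [Fin.ext_iff, Fin.succAbove, Fin.lt_def, Fin.val_castSucc]
        split_ifs <;> simp)
    have h₂ : (back h).app V ((reindex E (Fin.succAbove ⟨i.1, by lia⟩)).app V x) =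
        (back hr).app V x :=
      reindex_congr x (fun k ↦ by
        simp only [Fin.ext_iff, Fin.succAbove, Fin.lt_def, Fin.val_castSucc]
        split_ifs <;> simp <;> lia)
    rw [h₁, h₂, Fin.val_castSucc]
  · have h₁ : (front h).app V ((reindex E (Fin.succAbove ⟨r + 1 + j.1, by lia⟩)).app V x) =
        (front hs).app V x :=
      reindex_congr x (fun k ↦ by
        simp only [Fin.ext_iff, Fin.succAbove, Fin.lt_def, Fin.val_castSucc]
        split_ifs <;> simp <;> lia)
    have h₂ : (back h).app V ((reindex E (Fin.succAbove ⟨r + 1 + j.1, by lia⟩)).app V x) =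
        (reindex E j.succ.succAbove).app V ((back hs).app V x) :=
      reindex_congr x (fun k ↦ by
        simp only [Fin.ext_iff, Fin.succAbove, Fin.lt_def, Fin.val_castSucc]
        split_ifs <;> simp at * <;> lia)
    rw [h₁, h₂, ← pow_add, Fin.val_succ]
    congr 2
    lia
  · have h₁ : (reindex E (Fin.last (r + 1)).succAbove).app V ((front hr).app V x) =
        (front hs).app V x :=
      reindex_congr x (fun k ↦ by simp)
    have h₂ : (reindex E (Fin.succAbove 0)).app V ((back hs).app V x) = (back hr).app V x :=
      reindex_congr x (fun k ↦ by
        simp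
        lia)
    have h₃ : (-1 : ℤ) ^ (r + 1) + (-1 : ℤ) ^ r * (-1 : ℤ) ^ 0 = 0 := by
      rw [pow_succ]
      ring
    rw [h₁, h₂, ← add_smul, Fin.val_last, Fin.val_zero, h₃]
    exact zero_smul ℤ _

lemma cupCochain_zero_left {r s n : ℕ} (h : r + s = n) (b : free.obj (nerve E s) ⟶ Q) :
    cupCochain h (0 : free.obj (nerve E r) ⟶ P) b = 0 := by
  have := cupCochain_add_left h (0 : free.obj (nerve E r) ⟶ P) 0 b
  simpa using this

lemma cupCochain_zero_right {r s n : ℕ} (h : r + s = n) (a : free.obj (nerve E r) ⟶ P) :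
    cupCochain h a (0 : free.obj (nerve E s) ⟶ Q) = 0 := by
  have := cupCochain_add_right h a (0 : free.obj (nerve E s) ⟶ Q) 0
  simpa using this

lemma cechD_cupCochain_eq_zero {r s n : ℕ} (h : r + s = n) (a : free.obj (nerve E r) ⟶ P)
    (b : free.obj (nerve E s) ⟶ Q) (ha : cechD E r ≫ a = 0) (hb : cechD E s ≫ b = 0) :
    cechD E n ≫ cupCochain h a b = 0 := by
  rw [cechD_cupCochain, ha, hb, cupCochain_zero_left, cupCochain_zero_right, smul_zero, add_zero]

lemma cechD_cupCochain_left {r s n : ℕ} (h : r + s = n) (h' : (r + 1) + s = n + 1)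
    (a : free.obj (nerve E r) ⟶ P) (b : free.obj (nerve E s) ⟶ Q) (hb : cechD E s ≫ b = 0) :
    cechD E n ≫ cupCochain h a b = cupCochain h' (cechD E r ≫ a) b := by
  rw [cechD_cupCochain, hb, cupCochain_zero_right, smul_zero, add_zero]

lemma cechD_cupCochain_right {r s n : ℕ} (h : r + s = n) (h' : r + (s + 1) = n + 1)
    (a : free.obj (nerve E r) ⟶ P) (b : free.obj (nerve E s) ⟶ Q) (ha : cechD E r ≫ a = 0) :
    cechD E n ≫ ((-1 : ℤ) ^ r • cupCochain h a b) = cupCochain h' a (cechD E s ≫ b) := by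
  rw [Preadditive.comp_zsmul, cechD_cupCochain, ha, cupCochain_zero_left, zero_add, smul_smul,
    ← mul_pow]
  simp

variable (E P Q) in
/-- The cup product of Čech cocycles. -/
def cupCocycles (r s : ℕ) : (cechRes E).cocycles P r →+ (cechRes E).cocycles Q s →+
    (cechRes E).cocycles (P ⊗ Q) (r + s) :=
  AddMonoidHom.mk' (fun a ↦ AddMonoidHom.mk' (fun b ↦ ⟨cupCochain rfl a.1 b.1,
      cechD_cupCochain_eq_zero rfl a.1 b.1 a.2 b.2⟩)
    fun b b' ↦ Subtype.ext (cupCochain_add_right rfl a.1 b.1 b'.1)) fun a a' ↦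
    AddMonoidHom.ext fun b ↦ Subtype.ext (cupCochain_add_left rfl a.1 a'.1 b.1)

lemma cupCocycles_mem_left {r s : ℕ} (a : (cechRes E).cocycles P r) (b : (cechRes E).cocycles Q s)
    (ha : a.1 ∈ (cechRes E).coboundaries P r) :
    (cupCocycles E P Q r s a b).1 ∈ (cechRes E).coboundaries (P ⊗ Q) (r + s) := by
  obtain ⟨a, ha'⟩ := a
  cases r with
  | zero =>
    have h : a = 0 := ha
    subst h
    have : cupCocycles E P Q 0 s ⟨0, ha'⟩ b = 0 := Subtype.ext (cupCochain_zero_left _ _)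
    rw [this]
    exact zero_mem _
  | succ r =>
    obtain ⟨a, rfl⟩ := ha
    have key : ∀ (n : ℕ) (h₁ : r + s = n) (m : ℕ) (h₂ : (r + 1) + s = m) (_ : n + 1 = m),
        cupCochain h₂ (cechD E r ≫ a) b.1 ∈ (cechRes E).coboundaries (P ⊗ Q) m := by
      rintro n h₁ m h₂ rfl
      exact ⟨cupCochain h₁ a b.1, cechD_cupCochain_left h₁ h₂ a b.1 b.2⟩
    exact key (r + s) rfl _ rfl (by lia)

lemma cupCocycles_mem_right {r s : ℕ} (a : (cechRes E).cocycles P r) (b : (cechRes E).cocycles Q s)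
    (hb : b.1 ∈ (cechRes E).coboundaries Q s) :
    (cupCocycles E P Q r s a b).1 ∈ (cechRes E).coboundaries (P ⊗ Q) (r + s) := by
  obtain ⟨b, hb'⟩ := b
  cases s with
  | zero =>
    have h : b = 0 := hb
    subst h
    have : cupCocycles E P Q r 0 a ⟨0, hb'⟩ = 0 := Subtype.ext (cupCochain_zero_right _ _)
    rw [this]
    exact zero_mem _
  | succ s =>
    obtain ⟨b, rfl⟩ := hb
    exact ⟨(-1 : ℤ) ^ r • cupCochain rfl a.1 b, cechD_cupCochain_right rfl rfl a.1 b a.2⟩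

variable (E P Q) in
/-- The Alexander–Whitney cup product on the Čech cohomology of a family of morphisms. -/
def cechCup (r s : ℕ) : (cechRes E).Cohomology P r →+ (cechRes E).Cohomology Q s →+
    (cechRes E).Cohomology (P ⊗ Q) (r + s) :=
  QuotientAddGroup.lift _
    (AddMonoidHom.mk' (fun a ↦ QuotientAddGroup.map _ _ (cupCocycles E P Q r s a)
        fun b hb ↦ cupCocycles_mem_right a b hb) fun a a' ↦ by
      ext b
      exact congrArg (QuotientAddGroup.mk' _)
        (congrArg (fun f ↦ f b) (map_add (cupCocycles E P Q r s) a a')))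
    fun a ha ↦ by
      ext b
      exact (QuotientAddGroup.eq_zero_iff _).2 (cupCocycles_mem_left a b ha)

lemma cechCup_mk {r s : ℕ} (a : (cechRes E).cocycles P r) (b : (cechRes E).cocycles Q s) :
    cechCup E P Q r s (QuotientAddGroup.mk a) (QuotientAddGroup.mk b) =
      QuotientAddGroup.mk (cupCocycles E P Q r s a b) := rfl

end Cup

section SheafFlat

variable {C : Type u} [SmallCategory C] (J : GrothendieckTopology C)

open MonoidalClosed.FunctorCategory in
instance (M : Sheaf J Ab.{u}) : PreservesColimits (tensorLeft M) :=
  letI := Monoidal.Reflective.closed (sheafificationAdjunction J Ab.{u}) M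
  (ihom.adjunction M).leftAdjoint_preservesColimits

/-- The tensor product with a sheaf is the sheafification of a tensor product of presheaves. -/
def tensorLeftIso (M : Sheaf J Ab.{u}) :
    sheafToPresheaf J Ab.{u} ⋙ tensorLeft M.obj ⋙ presheafToSheaf J Ab.{u} ≅ tensorLeft M :=
  let adj := sheafificationAdjunction J Ab.{u}
  NatIso.ofComponents (fun _ ↦
    (Functor.Monoidal.μIso (presheafToSheaf J Ab.{u}) _ _).symm ≪≫
      asIso ((adj.counit.app _) ⊗ₘ (adj.counit.app _))) (fun f ↦ by
    have h := adj.counit_naturality f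
    change (presheafToSheaf J Ab.{u}).map (M.obj ◁ f.hom) ≫
      Functor.OplaxMonoidal.δ (presheafToSheaf J Ab.{u}) _ _ ≫
        (adj.counit.app _ ⊗ₘ adj.counit.app _) =
      (Functor.OplaxMonoidal.δ (presheafToSheaf J Ab.{u}) _ _ ≫
        (adj.counit.app _ ⊗ₘ adj.counit.app _)) ≫ M ◁ f
    rw [Category.assoc, ← Functor.OplaxMonoidal.δ_natural_right_assoc,
      MonoidalCategory.tensorHom_def', ← MonoidalCategory.whiskerLeft_comp_assoc]
    erw [h]
    rw [MonoidalCategory.whisker_exchange,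
      MonoidalCategory.tensorHom_def_assoc, MonoidalCategory.whiskerLeft_comp]
    rfl)

lemma torsionFree_obj {M : Sheaf J Ab.{u}} (hM : TorsionFree M) : TorsionFree M.obj := fun n hn ↦ by
  have := hM n hn
  have h : (sheafToPresheaf J Ab.{u}).map (n • 𝟙 M) = n • 𝟙 M.obj := by
    rw [Functor.map_zsmul, CategoryTheory.Functor.map_id]
    rfl
  rw [← h]
  infer_instance

lemma torsionFree_sheafify {P : Cᵒᵖ ⥤ Ab.{u}} (hP : TorsionFree P) :
    TorsionFree ((presheafToSheaf J Ab.{u}).obj P) := fun n hn ↦ by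
  have := hP n hn
  have h : (presheafToSheaf J Ab.{u}).map (n • 𝟙 P) = n • 𝟙 _ := by
    rw [Functor.map_zsmul, CategoryTheory.Functor.map_id]
  rw [← h]
  infer_instance

instance : HasTorsionFreeCovers (Sheaf J Ab.{u}) where
  flat M hM := by
    have := flat_of_torsionFree_presheaf M.obj (torsionFree_obj J hM)
    have h₁ : PreservesFiniteColimits (tensorLeft M) := inferInstance
    have h₂ : PreservesFiniteLimits (tensorLeft M) :=
      preservesFiniteLimits_of_natIso (tensorLeftIso J M)
    let e : tensorLeft M ≅ tensorRight M := BraidedCategory.tensorLeftIsoTensorRight M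
    exact ⟨h₂, h₁, preservesFiniteLimits_of_natIso e, preservesFiniteColimits_of_natIso e⟩
  cover F := by
    obtain ⟨M, p, hM, hp⟩ := HasTorsionFreeCovers.cover F.obj
    refine ⟨(presheafToSheaf J Ab.{u}).obj M, (presheafToSheaf J Ab.{u}).map p ≫
      (sheafificationAdjunction J Ab.{u}).counit.app F, torsionFree_sheafify J hM, ?_⟩
    have : Epi ((presheafToSheaf J Ab.{u}).map p) := inferInstance
    exact epi_comp _ _

end SheafFlat

section CupProducts

variable {C : Type u} [SmallCategory C]

section Presheaves

variable {U : C} (E : PreZeroHypercover.{u} U)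

/-- The cup product on the derived functors `Extʳ(ℤ[S], -)` of the functor
`Hom(ℤ[S], -) = Ȟ⁰(E, -)` on presheaves, where `S` is the sieve generated by the family `E`. -/
def presheafCup {P Q : Cᵒᵖ ⥤ Ab.{u}} {r s : ℕ} (x : Ext.{u} (free.obj E.sieve₀.functor) P r)
    (y : Ext.{u} (free.obj E.sieve₀.functor) Q s) :
    Ext.{u} (free.obj E.sieve₀.functor) (P ⊗ Q) (r + s) :=
  (Ext.mk₀ (diag E.sieve₀.functor)).comp
    (derivedTensor (torsionFree_free _) (torsionFree_free _) x y) (zero_add _)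

end Presheaves

variable (J : GrothendieckTopology C) (U : C)

/-- The sheaf `ℤ_U`, associated with the presheaf `V ↦ ℤ[Hom(V, U)]`; it represents the functor
of sections over `U`. -/
def zSheaf : Sheaf J Ab.{u} := (presheafToSheaf J Ab.{u}).obj (free.obj (yoneda.obj U))

/-- The diagonal `ℤ_U ⟶ ℤ_U ⊗ ℤ_U`. -/
def zDiag : zSheaf J U ⟶ zSheaf J U ⊗ zSheaf J U :=
  (presheafToSheaf J Ab.{u}).map (diag (yoneda.obj U)) ≫
    Functor.OplaxMonoidal.δ (presheafToSheaf J Ab.{u}) _ _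

lemma torsionFree_zSheaf : TorsionFree (zSheaf J U) :=
  torsionFree_sheafify J (torsionFree_free _)

variable {J}

/-- The sheaf cohomology `Hⁿ(U, F)`, the `n`-th derived functor of `F ↦ F(U) = Hom(ℤ_U, F)`. -/
abbrev H (F : Sheaf J Ab.{u}) (n : ℕ) : Type u := Ext.{u} (zSheaf J U) F n

variable {U}

/-- The cup product `Hʳ(U, A) × Hˢ(U, B) ⟶ H^{r+s}(U, A ⊗ B)` of derived functor cohomology. -/
def cup {A B : Sheaf J Ab.{u}} {r s : ℕ} (x : H U A r) (y : H U B s) : H U (A ⊗ B) (r + s) :=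
  (Ext.mk₀ (zDiag J U)).comp
    (derivedTensor (torsionFree_zSheaf J U) (torsionFree_zSheaf J U) x y) (zero_add _)

/-- The canonical morphism from the tensor product of `A` and `B` as presheaves to their tensor
product as sheaves. -/
def tensorToSheaf (A B : Sheaf J Ab.{u}) : A.obj ⊗ B.obj ⟶ (A ⊗ B).obj :=
  ((sheafificationAdjunction J Ab.{u}).homEquiv _ _)
    (Functor.OplaxMonoidal.δ (presheafToSheaf J Ab.{u}) A.obj B.obj ≫
      ((sheafificationAdjunction J Ab.{u}).counit.app A ⊗ₘ
        (sheafificationAdjunction J Ab.{u}).counit.app B))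

/-- The free presheaf functor is left adjoint to the forgetful functor. -/
def freeAdj : free (C := C) ⊣ (Functor.whiskeringRight Cᵒᵖ Ab.{u} (Type u)).obj (forget _) :=
  (ModuleCat.adj (ULift.{u} ℤ)).whiskerRight Cᵒᵖ

lemma isIso_sieve {S : Sieve U} (hS : S ∈ J U) :
    IsIso ((presheafToSheaf J Ab.{u}).map (free.map S.functorInclusion)) := by
  rw [← GrothendieckTopology.W_iff]
  intro P hP
  have h : Presieve.IsSheaf J (P ⋙ forget Ab.{u}) :=
    (isSheaf_iff_isSheaf_of_type J _).1
      ((Presheaf.isSheaf_iff_isSheaf_comp J P (forget Ab.{u})).1 hP)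
  have h' := Presieve.isSheafFor_iff_yonedaSheafCondition.1 (h S hS)
  rw [← Function.Bijective.of_comp_iff' (freeAdj.homEquiv S.functor P).bijective]
  have : (freeAdj.homEquiv S.functor P) ∘ (fun g ↦ free.map S.functorInclusion ≫ g) =
      (fun g ↦ S.functorInclusion ≫ g) ∘ (freeAdj.homEquiv (yoneda.obj U) P) :=
    funext fun g ↦ freeAdj.homEquiv_naturality_left _ _
  rw [this]
  exact ((Function.bijective_iff_existsUnique _).2 h').comp (freeAdj.homEquiv _ _).bijective

/-- The isomorphism of the sheaf associated with `ℤ[S]` with `ℤ_U`, for a covering sieve `S`. -/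
def sieveIso {S : Sieve U} (hS : S ∈ J U) :
    (presheafToSheaf J Ab.{u}).obj (free.obj S.functor) ≅ zSheaf J U :=
  @asIso _ _ _ _ ((presheafToSheaf J Ab.{u}).map (free.map S.functorInclusion)) (isIso_sieve hS)

/-- The edge morphism `Extⁿ(ℤ[S], F) ⟶ Hⁿ(U, F)`, for a covering sieve `S`. Here `Ext` on the left
hand side is taken in the category of presheaves. As sheafification is exact, it maps
`Extⁿ(ℤ[S], F)` to the group `Ext` of the associated sheaves, which are `ℤ_U` and `F`. -/
def edge {S : Sieve U} (hS : S ∈ J U) (F : Sheaf J Ab.{u}) (n : ℕ) :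
    Ext.{u} (free.obj S.functor) F.obj n →+ H U F n :=
  ((Ext.mk₀ (sieveIso hS).inv).precomp F (zero_add n)).comp
    (((Ext.mk₀ ((sheafificationAdjunction J Ab.{u}).counit.app F)).postcomp _ (add_zero n)).comp
      ((presheafToSheaf J Ab.{u}).mapExtAddHom _ _ n))

end CupProducts

section CechComparison

variable {C : Type u} [SmallCategory C] {J : GrothendieckTopology C} {U : C}

section Family

variable {E : PreZeroHypercover.{u} U}

/-- The map from the Čech cohomology of a covering family `E` of `U` with values in a sheaf `F` to
the derived functor cohomology: the composition of the canonical map from Čech cohomology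
to `Extⁿ(ℤ[S], F)`, where `S` is the sieve generated by `E`, with the edge morphism. (If the fibre
products over `U` exist, the first map is an isomorphism, as then the presheaves `ℤ[N_n]` are
projective.) -/
def cechToH (hE : E.sieve₀ ∈ J U) (F : Sheaf J Ab.{u}) (n : ℕ) :
    (cechRes E).Cohomology F.obj n →+ H U F n :=
  (edge hE F n).comp ((cechRes E).toExt F.obj n)

variable (E) in
/-- The cup product on the Čech cohomology of a family `E` with coefficients in sheaves. -/
def sheafCechCup (A B : Sheaf J Ab.{u}) (r s : ℕ) : (cechRes E).Cohomology A.obj r →+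
    (cechRes E).Cohomology B.obj s →+ (cechRes E).Cohomology (A ⊗ B).obj (r + s) :=
  (AddMonoidHom.compHom ((cechRes E).mapCoeff (tensorToSheaf A B) (r + s))).comp
    (cechCup E A.obj B.obj r s)

end Family

section Refinement

variable {E E' E'' : PreZeroHypercover.{u} U}

/-- The morphism of Čech nerves induced by a refinement `φ : E ⟶ E'`. -/
def nerveMap (φ : E.Hom E') (n : ℕ) : nerve E n ⟶ nerve E' n where
  app V := TypeCat.ofHom fun x ↦ ⟨fun k ↦ ⟨φ.s₀ (x.1 k).1, (x.1 k).2 ≫ φ.h₀ (x.1 k).1⟩,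
    fun k l ↦ by simpa using x.2 k l⟩
  naturality V W f := by
    ext x
    exact Subtype.ext (funext fun k ↦ Sigma.ext rfl (heq_of_eq (Category.assoc _ _ _)))

lemma nerveMap_reindex (φ : E.Hom E') {m n : ℕ} (ψ : Fin (m + 1) → Fin (n + 1)) :
    nerveMap φ n ≫ reindex E' ψ = reindex E ψ ≫ nerveMap φ m := rfl

lemma nerveMap_nerveAug (φ : E.Hom E') :
    nerveMap φ 0 ≫ nerveAug E' = nerveAug E ≫ Sieve.natTransOfLe φ.sieve₀_le_sieve₀ := by
  ext V x
  refine Subtype.ext ?_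
  change ((x.1 0).2 ≫ φ.h₀ (x.1 0).1) ≫ E'.f _ = (x.1 0).2 ≫ E.f _
  simp

/-- The morphism of Čech resolutions induced by a refinement. -/
def cechResMap (φ : E.Hom E') : (cechRes E).Hom (cechRes E')
    (free.map (Sieve.natTransOfLe φ.sieve₀_le_sieve₀)) where
  f n := free.map (nerveMap φ n)
  comm n := by
    change free.map (nerveMap φ (n + 1)) ≫ cechD E' n = cechD E n ≫ free.map (nerveMap φ n)
    rw [cechD, cechD, Preadditive.comp_sum, Preadditive.sum_comp]
    refine Finset.sum_congr rfl fun i _ ↦ ?_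
    rw [Preadditive.comp_zsmul, Preadditive.zsmul_comp, ← Functor.map_comp, ← Functor.map_comp,
      nerveMap_reindex]
  comm_ε := by
    change free.map (nerveMap φ 0) ≫ free.map (nerveAug E') = free.map (nerveAug E) ≫ _
    rw [← Functor.map_comp, ← Functor.map_comp, nerveMap_nerveAug]

lemma cupCochain_nerveMap (φ : E.Hom E') {P Q : Cᵒᵖ ⥤ Ab.{u}} {r s n : ℕ} (h : r + s = n)
    (a : free.obj (nerve E' r) ⟶ P) (b : free.obj (nerve E' s) ⟶ Q) :
    free.map (nerveMap φ n) ≫ cupCochain h a b =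
      cupCochain h (free.map (nerveMap φ r) ≫ a) (free.map (nerveMap φ s) ≫ b) := by
  refine free_hom_ext fun V x ↦ ?_
  rw [cupCochain_gen]
  change (cupCochain h a b).app V ((free.map (nerveMap φ n)).app V (gen x)) =
    tmul V (a.app V ((free.map (nerveMap φ r)).app V (gen _)))
      (b.app V ((free.map (nerveMap φ s)).app V (gen _)))
  rw [free_map_gen, cupCochain_gen, free_map_gen, free_map_gen]
  rfl

lemma cechCup_mapCohomology (φ : E.Hom E') {P Q : Cᵒᵖ ⥤ Ab.{u}} {r s : ℕ}
    (x : (cechRes E').Cohomology P r) (y : (cechRes E').Cohomology Q s) :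
    (cechResMap φ).mapCohomology (P ⊗ Q) (r + s) (cechCup E' P Q r s x y) =
      cechCup E P Q r s ((cechResMap φ).mapCohomology P r x)
        ((cechResMap φ).mapCohomology Q s y) := by
  obtain ⟨a, rfl⟩ := QuotientAddGroup.mk_surjective x
  obtain ⟨b, rfl⟩ := QuotientAddGroup.mk_surjective y
  exact congrArg (QuotientAddGroup.mk' _) (Subtype.ext (cupCochain_nerveMap φ rfl a.1 b.1))

lemma edge_apply {S : Sieve U} (hS : S ∈ J U) (F : Sheaf J Ab.{u}) (n : ℕ)
    (x : Ext.{u} (free.obj S.functor) F.obj n) :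
    edge hS F n x = (Ext.mk₀ (sieveIso hS).inv).comp
      ((x.mapExactFunctor (presheafToSheaf J Ab.{u})).comp
        (Ext.mk₀ ((sheafificationAdjunction J Ab.{u}).counit.app F)) (add_zero n))
      (zero_add n) := rfl

lemma edge_natTransOfLe {S T : Sieve U} (hST : S ≤ T) (hS : S ∈ J U) (hT : T ∈ J U)
    (F : Sheaf J Ab.{u}) (n : ℕ) (x : Ext.{u} (free.obj T.functor) F.obj n) :
    edge hS F n ((Ext.mk₀ (free.map (Sieve.natTransOfLe hST))).comp x (zero_add n)) =
      edge hT F n x := by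
  have h : (sieveIso hS).inv ≫ (presheafToSheaf J Ab.{u}).map
      (free.map (Sieve.natTransOfLe hST)) = (sieveIso hT).inv := by
    rw [Iso.inv_comp_eq, Iso.eq_comp_inv]
    change (presheafToSheaf J Ab.{u}).map _ ≫ (presheafToSheaf J Ab.{u}).map _ =
      (presheafToSheaf J Ab.{u}).map _
    rw [← Functor.map_comp, ← Functor.map_comp]
    rfl
  rw [edge_apply, edge_apply, Ext.mapExactFunctor_comp, Ext.mapExactFunctor_mk₀, ← h,
    ← Ext.mk₀_comp_mk₀, Ext.comp_assoc (a₁₂ := n) (a₂₃ := n) _ _ _ (by lia) (by lia) (by lia),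
    Ext.comp_assoc (a₁₂ := 0) (a₂₃ := n) _ _ _ (by lia) (by lia) (by lia)]

lemma cechToH_mapCohomology (φ : E.Hom E') (hE : E.sieve₀ ∈ J U) (hE' : E'.sieve₀ ∈ J U)
    (F : Sheaf J Ab.{u}) (n : ℕ) (x : (cechRes E').Cohomology F.obj n) :
    cechToH hE F n ((cechResMap φ).mapCohomology F.obj n x) = cechToH hE' F n x := by
  change edge hE F n ((cechRes E).toExt F.obj n _) = edge hE' F n ((cechRes E').toExt F.obj n x)
  rw [Resolution.Hom.toExt_mapCohomology, edge_natTransOfLe]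

end Refinement

section Limit

/-- The family of all morphisms in a covering sieve. -/
def family (S : J.Cover U) : PreZeroHypercover.{u} U where
  I₀ := S.Arrow
  X i := i.Y
  f i := i.f

lemma family_mem (S : J.Cover U) : (family S).sieve₀ ∈ J U := by
  refine J.superset_covering ?_ S.2
  intro V f hf
  exact (family S).sieve₀_f (⟨V, f, hf⟩ : S.Arrow)

/-- The refinement of the family of all morphisms in a covering sieve by a smaller one. -/
def familyMap {S T : J.Cover U} (h : S ⟶ T) : (family S).Hom (family T) where
  s₀ i := i.map h
  h₀ _ := 𝟙 _
  w₀ _ := Category.id_comp _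

/-- The Čech cohomology groups of the covering sieves of `U`. -/
def cechSystem (J : GrothendieckTopology C) (U : C) (P : Cᵒᵖ ⥤ Ab.{u}) (n : ℕ) :
    (J.Cover U)ᵒᵖ ⥤ AddCommGrpCat.{u} where
  obj S := AddCommGrpCat.of ((cechRes (family S.unop)).Cohomology P n)
  map h := AddCommGrpCat.ofHom ((cechResMap (familyMap h.unop)).mapCohomology P n)
  map_id S := by
    ext a
    refine congrArg (QuotientAddGroup.mk' _) (Subtype.ext ?_)
    change free.map (nerveMap (familyMap (𝟙 S.unop)) n) ≫ a.1 = a.1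
    have h : nerveMap (familyMap (𝟙 S.unop)) n = 𝟙 _ := by
      ext V x
      exact Subtype.ext (funext fun k ↦ Sigma.ext rfl (heq_of_eq (Category.comp_id _)))
    rw [h, CategoryTheory.Functor.map_id]
    exact Category.id_comp _
  map_comp h k := by
    ext a
    refine congrArg (QuotientAddGroup.mk' _) (Subtype.ext ?_)
    change free.map (nerveMap (familyMap (h ≫ k).unop) n) ≫ a.1 =
      free.map (nerveMap (familyMap k.unop) n) ≫ free.map (nerveMap (familyMap h.unop) n) ≫ a.1
    have e : nerveMap (familyMap (h ≫ k).unop) n =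
        nerveMap (familyMap k.unop) n ≫ nerveMap (familyMap h.unop) n := by
      ext V x
      refine Subtype.ext (funext fun i ↦ Sigma.ext rfl (heq_of_eq ?_))
      exact (Category.comp_id (x.1 i).2).trans ((Category.comp_id _).trans
        (Category.comp_id (x.1 i).2)).symm
    rw [e, Functor.map_comp]
    exact Category.assoc _ _ _

/-- The Čech cohomology `Ȟⁿ(U, P)` of a presheaf `P`: the colimit of the Čech cohomology groups
over all covering sieves of `U`. -/
abbrev CechH (J : GrothendieckTopology C) (U : C) (P : Cᵒᵖ ⥤ Ab.{u}) (n : ℕ) : AddCommGrpCat.{u} :=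
  colimit (cechSystem J U P n)

/-- The canonical homomorphism from the Čech cohomology of a covering sieve to `Ȟⁿ(U, P)`. -/
def cechι (S : J.Cover U) (P : Cᵒᵖ ⥤ Ab.{u}) (n : ℕ) :
    (cechRes (family S)).Cohomology P n →+ CechH J U P n :=
  (colimit.ι (cechSystem J U P n) (op S)).hom

lemma cechι_map {S T : J.Cover U} (h : S ⟶ T) (P : Cᵒᵖ ⥤ Ab.{u}) (n : ℕ)
    (x : (cechRes (family T)).Cohomology P n) :
    cechι S P n ((cechResMap (familyMap h)).mapCohomology P n x) = cechι T P n x :=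
  congrArg (fun f ↦ f.hom x) (colimit.w (cechSystem J U P n) h.op)

lemma exists_cechι {P : Cᵒᵖ ⥤ Ab.{u}} {n : ℕ} (x : CechH J U P n) :
    ∃ (S : J.Cover U) (a : (cechRes (family S)).Cohomology P n), cechι S P n a = x := by
  obtain ⟨S, a, h⟩ := Concrete.colimit_exists_rep (cechSystem J U P n) x
  exact ⟨S.unop, a, h⟩

lemma exists_of_cechι_eq {P : Cᵒᵖ ⥤ Ab.{u}} {n : ℕ} {S T : J.Cover U}
    (a : (cechRes (family S)).Cohomology P n) (b : (cechRes (family T)).Cohomology P n)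
    (h : cechι S P n a = cechι T P n b) : ∃ (W : J.Cover U) (f : W ⟶ S) (g : W ⟶ T),
      (cechResMap (familyMap f)).mapCohomology P n a =
        (cechResMap (familyMap g)).mapCohomology P n b := by
  obtain ⟨W, f, g, h⟩ := Concrete.colimit_exists_of_rep_eq (cechSystem J U P n)
    (i := op S) (j := op T) a b h
  exact ⟨W.unop, f.unop, g.unop, h⟩

lemma mapCohomology_familyMap_comp {P : Cᵒᵖ ⥤ Ab.{u}} {n : ℕ} {S T W : J.Cover U} (f : S ⟶ T)
    (g : T ⟶ W) (x : (cechRes (family W)).Cohomology P n) :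
    (cechResMap (familyMap f)).mapCohomology P n
      ((cechResMap (familyMap g)).mapCohomology P n x) =
        (cechResMap (familyMap (f ≫ g))).mapCohomology P n x :=
  (congrArg (fun k ↦ k.hom x) ((cechSystem J U P n).map_comp g.op f.op)).symm

lemma cechι_cechCup_congr {P Q : Cᵒᵖ ⥤ Ab.{u}} {r s : ℕ} {S T : J.Cover U}
    (a : (cechRes (family S)).Cohomology P r) (b : (cechRes (family S)).Cohomology Q s)
    (a' : (cechRes (family T)).Cohomology P r) (b' : (cechRes (family T)).Cohomology Q s)
    (ha : cechι S P r a = cechι T P r a') (hb : cechι S Q s b = cechι T Q s b') :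
    cechι S (P ⊗ Q) (r + s) (cechCup _ P Q r s a b) =
      cechι T (P ⊗ Q) (r + s) (cechCup _ P Q r s a' b') := by
  obtain ⟨W₁, f₁, g₁, h₁⟩ := exists_of_cechι_eq a a' ha
  obtain ⟨W₂, f₂, g₂, h₂⟩ := exists_of_cechι_eq b b' hb
  let k₁ : W₁ ⊓ W₂ ⟶ W₁ := homOfLE inf_le_left
  let k₂ : W₁ ⊓ W₂ ⟶ W₂ := homOfLE inf_le_right
  have h₁' := congrArg ((cechResMap (familyMap k₁)).mapCohomology P r) h₁
  have h₂' := congrArg ((cechResMap (familyMap k₂)).mapCohomology Q s) h₂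
  rw [mapCohomology_familyMap_comp, mapCohomology_familyMap_comp] at h₁' h₂'
  rw [← cechι_map (k₁ ≫ f₁), ← cechι_map (k₁ ≫ g₁), cechCup_mapCohomology, cechCup_mapCohomology,
    h₁']
  obtain e : k₁ ≫ f₁ = k₂ ≫ f₂ := Subsingleton.elim _ _
  obtain e' : k₁ ≫ g₁ = k₂ ≫ g₂ := Subsingleton.elim _ _
  rw [e, h₂', ← e']

lemma exists_cechι₂ {P Q : Cᵒᵖ ⥤ Ab.{u}} {r s : ℕ} (x : CechH J U P r) (y : CechH J U Q s) :
    ∃ (S : J.Cover U) (a : (cechRes (family S)).Cohomology P r)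
      (b : (cechRes (family S)).Cohomology Q s), cechι S P r a = x ∧ cechι S Q s b = y := by
  obtain ⟨S, a, rfl⟩ := exists_cechι x
  obtain ⟨T, b, rfl⟩ := exists_cechι y
  exact ⟨S ⊓ T, _, _, cechι_map (homOfLE inf_le_left) P r a,
    cechι_map (homOfLE inf_le_right) Q s b⟩

/-- The cup product on `Ȟ(U, -)`, computed by the Alexander–Whitney formula for representatives with
respect to a common covering sieve. -/
def limCup {P Q : Cᵒᵖ ⥤ Ab.{u}} {r s : ℕ} (x : CechH J U P r) (y : CechH J U Q s) :
    CechH J U (P ⊗ Q) (r + s) :=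
  cechι (exists_cechι₂ x y).choose (P ⊗ Q) (r + s)
    (cechCup _ P Q r s (exists_cechι₂ x y).choose_spec.choose
      (exists_cechι₂ x y).choose_spec.choose_spec.choose)

lemma limCup_cechι (S : J.Cover U) {P Q : Cᵒᵖ ⥤ Ab.{u}} {r s : ℕ}
    (a : (cechRes (family S)).Cohomology P r) (b : (cechRes (family S)).Cohomology Q s) :
    limCup (cechι S P r a) (cechι S Q s b) = cechι S (P ⊗ Q) (r + s) (cechCup _ P Q r s a b) := by
  have h := (exists_cechι₂ (cechι S P r a)
    (cechι S Q s b)).choose_spec.choose_spec.choose_spec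
  exact cechι_cechCup_congr _ _ a b h.1 h.2

lemma mapCoeff_mapCohomology {S T : J.Cover U} (h : S ⟶ T) {P Q : Cᵒᵖ ⥤ Ab.{u}} (φ : P ⟶ Q)
    (n : ℕ) (x : (cechRes (family T)).Cohomology P n) :
    (cechRes (family S)).mapCoeff φ n ((cechResMap (familyMap h)).mapCohomology P n x) =
      (cechResMap (familyMap h)).mapCohomology Q n ((cechRes (family T)).mapCoeff φ n x) := by
  obtain ⟨a, rfl⟩ := QuotientAddGroup.mk_surjective x
  refine congrArg (QuotientAddGroup.mk' _) (Subtype.ext ?_)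
  change ((cechResMap (familyMap h)).f n ≫ a.1) ≫ φ = (cechResMap (familyMap h)).f n ≫ a.1 ≫ φ
  exact Category.assoc _ _ _

/-- The maps on the Čech cohomology of covering sieves induced by a morphism of presheaves. -/
def cechSystemMap {P Q : Cᵒᵖ ⥤ Ab.{u}} (φ : P ⟶ Q) (n : ℕ) :
    cechSystem J U P n ⟶ cechSystem J U Q n where
  app S := AddCommGrpCat.ofHom ((cechRes (family S.unop)).mapCoeff φ n)
  naturality _ _ h := AddCommGrpCat.hom_ext (AddMonoidHom.ext fun a ↦
    mapCoeff_mapCohomology h.unop φ n a)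

/-- The map `Ȟⁿ(U, P) ⟶ Ȟⁿ(U, Q)` induced by a morphism of presheaves. -/
def limMapCoeff {P Q : Cᵒᵖ ⥤ Ab.{u}} (φ : P ⟶ Q) (n : ℕ) : CechH J U P n →+ CechH J U Q n :=
  (colimMap (cechSystemMap φ n)).hom

lemma limMapCoeff_cechι (S : J.Cover U) {P Q : Cᵒᵖ ⥤ Ab.{u}} (φ : P ⟶ Q) (n : ℕ)
    (a : (cechRes (family S)).Cohomology P n) :
    limMapCoeff φ n (cechι S P n a) = cechι S Q n ((cechRes (family S)).mapCoeff φ n a) :=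
  congrArg (fun (f : (cechSystem J U P n).obj (op S) ⟶ CechH J U Q n) ↦ f.hom a)
    (ι_colimMap (cechSystemMap φ n) (op S))

/-- The cup product `Ȟʳ(U, A) × Ȟˢ(U, B) ⟶ Ȟ^{r+s}(U, A ⊗ B)` with coefficients in sheaves. -/
def sheafLimCup {A B : Sheaf J Ab.{u}} {r s : ℕ} (x : CechH J U A.obj r) (y : CechH J U B.obj s) :
    CechH J U (A ⊗ B).obj (r + s) :=
  limMapCoeff (tensorToSheaf A B) (r + s) (limCup x y)

lemma sheafLimCup_cechι (S : J.Cover U) {A B : Sheaf J Ab.{u}} {r s : ℕ}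
    (a : (cechRes (family S)).Cohomology A.obj r) (b : (cechRes (family S)).Cohomology B.obj s) :
    sheafLimCup (cechι S A.obj r a) (cechι S B.obj s b) =
      cechι S (A ⊗ B).obj (r + s) (sheafCechCup _ A B r s a b) := by
  rw [sheafLimCup, limCup_cechι, limMapCoeff_cechι]
  rfl

/-- The cocone of the edge morphisms of the covering sieves of `U`. -/
def edgeCocone (F : Sheaf J Ab.{u}) (n : ℕ) : Cocone (cechSystem J U F.obj n) where
  pt := AddCommGrpCat.of (H U F n)
  ι :=
    { app S := AddCommGrpCat.ofHom (cechToH (family_mem S.unop) F n)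
      naturality _ _ h := AddCommGrpCat.hom_ext (AddMonoidHom.ext fun a ↦
        cechToH_mapCohomology (familyMap h.unop) (family_mem _) (family_mem _) F n a) }

/-- The edge morphism `Ȟⁿ(U, F) ⟶ Hⁿ(U, F)`, the colimit of the edge morphisms of the covering
sieves. -/
def limToH (F : Sheaf J Ab.{u}) (n : ℕ) : CechH J U F.obj n →+ H U F n :=
  (colimit.desc (cechSystem J U F.obj n) (edgeCocone F n)).hom

lemma limToH_cechι (S : J.Cover U) (F : Sheaf J Ab.{u}) (n : ℕ)
    (a : (cechRes (family S)).Cohomology F.obj n) :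
    limToH F n (cechι S F.obj n a) = cechToH (family_mem S) F n a :=
  congrArg (fun (f : (cechSystem J U F.obj n).obj (op S) ⟶ AddCommGrpCat.of (H U F n)) ↦ f.hom a)
    (colimit.ι_desc (edgeCocone F n) (op S))

end Limit

end CechComparison

section Cocycles

variable {C : Type u} [SmallCategory C] {J : GrothendieckTopology C} {U : C}
  {E : PreZeroHypercover.{u} U}

/-- The value `a(x₀, …, xₙ)` of a Čech cochain. -/
def value {n : ℕ} {P : Cᵒᵖ ⥤ Ab.{u}} (a : (cechRes E).X n ⟶ P) {V : Cᵒᵖ} (x : (nerve E n).obj V) :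
    P.obj V :=
  a.app V (gen x)

/-- The local section `α ⊗ β` of the sheaf `A ⊗ B`. -/
def sectionTensor {A B : Sheaf J Ab.{u}} {V : Cᵒᵖ} (α : A.obj.obj V) (β : B.obj.obj V) :
    (A ⊗ B).obj.obj V :=
  (tensorToSheaf A B).app V (tmul V α β)

/-- The Alexander–Whitney formula for Čech cochains `a`, `b`, `c` with values in sheaves `A`, `B`
and `A ⊗ B`: one has `c(x₀, …, x_{r+s}) = a(x₀, …, x_r) ⊗ b(x_r, …, x_{r+s})`. -/
def IsAlexanderWhitney {A B : Sheaf J Ab.{u}} {r s : ℕ} (a : (cechRes E).X r ⟶ A.obj)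
    (b : (cechRes E).X s ⟶ B.obj) (c : (cechRes E).X (r + s) ⟶ (A ⊗ B).obj) : Prop :=
  ∀ (V : Cᵒᵖ) (x : (nerve E (r + s)).obj V),
    value c x = sectionTensor (value a ((front rfl).app V x)) (value b ((back rfl).app V x))

lemma sheafCechCup_mk {A B : Sheaf J Ab.{u}} {r s : ℕ} (a : (cechRes E).cocycles A.obj r)
    (b : (cechRes E).cocycles B.obj s) (c : (cechRes E).cocycles (A ⊗ B).obj (r + s))
    (h : IsAlexanderWhitney a.1 b.1 c.1) :
    sheafCechCup E A B r s (QuotientAddGroup.mk a) (QuotientAddGroup.mk b) =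
      QuotientAddGroup.mk c := by
  refine congrArg (QuotientAddGroup.mk' _) (Subtype.ext ?_)
  change cupCochain rfl a.1 b.1 ≫ tensorToSheaf A B = c.1
  refine free_hom_ext fun V x ↦ ?_
  refine Eq.trans ?_ (h V x).symm
  exact congrArg ((tensorToSheaf A B).app V) (cupCochain_gen rfl a.1 b.1 x)

lemma value_map {n : ℕ} {P : Cᵒᵖ ⥤ Ab.{u}} (a : (cechRes E).X n ⟶ P) {V W : Cᵒᵖ} (f : V ⟶ W)
    (x : (nerve E n).obj V) : value a ((nerve E n).map f x) = P.map f (value a x) := by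
  have h : (free.obj (nerve E n)).map f (gen x) = gen ((nerve E n).map f x) :=
    ModuleCat.free_map_apply _ _
  have h' : a.app W ((free.obj (nerve E n)).map f (gen x)) = P.map f (a.app V (gen x)) :=
    NatTrans.naturality_apply (F := free.obj (nerve E n)) a f (gen x)
  rw [h] at h'
  exact h'

lemma value_homEquiv_symm {n : ℕ} {P : Cᵒᵖ ⥤ Ab.{u}} (τ : nerve E n ⟶ P ⋙ forget _) {V : Cᵒᵖ}
    (x : (nerve E n).obj V) : value ((freeAdj.homEquiv (nerve E n) P).symm τ) x = τ.app V x := by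
  have h := (freeAdj.homEquiv (nerve E n) P).apply_symm_apply τ
  exact congrArg (fun (σ : nerve E n ⟶ P ⋙ forget _) ↦ σ.app V x) h

lemma ext_value {n : ℕ} {P : Cᵒᵖ ⥤ Ab.{u}} {a b : (cechRes E).X n ⟶ P}
    (h : ∀ (V : Cᵒᵖ) (x : (nerve E n).obj V), value a x = value b x) : a = b :=
  free_hom_ext h

/-- The fibre product `X i₀ ×_U ⋯ ×_U X iₙ`. -/
abbrev fibreProduct {n : ℕ} (i : Fin (n + 1) → E.I₀)
    [HasWidePullback U (fun k ↦ E.X (i k)) (fun k ↦ E.f (i k))] : C :=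
  widePullback U (fun k ↦ E.X (i k)) (fun k ↦ E.f (i k))

/-- The tuple of the projections of a fibre product. -/
def projections {n : ℕ} (i : Fin (n + 1) → E.I₀)
    [HasWidePullback U (fun k ↦ E.X (i k)) (fun k ↦ E.f (i k))] :
    (nerve E n).obj (op (fibreProduct i)) :=
  ⟨fun k ↦ ⟨i k, WidePullback.π (fun k ↦ E.f (i k)) k⟩, fun k l ↦ by simp⟩

/-- The morphism to a fibre product defined by a tuple in the Čech nerve. -/
def toFibreProduct {n : ℕ} {V : Cᵒᵖ} (x : (nerve E n).obj V)
    [HasWidePullback U (fun k ↦ E.X (x.1 k).1) (fun k ↦ E.f (x.1 k).1)] :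
    V.unop ⟶ fibreProduct fun k ↦ (x.1 k).1 :=
  WidePullback.lift ((x.1 0).2 ≫ E.f _) (fun k ↦ (x.1 k).2) fun k ↦ x.2 k 0

lemma toFibreProduct_π {n : ℕ} {V : Cᵒᵖ} (x : (nerve E n).obj V)
    [HasWidePullback U (fun k ↦ E.X (x.1 k).1) (fun k ↦ E.f (x.1 k).1)] (k : Fin (n + 1)) :
    toFibreProduct x ≫ WidePullback.π (fun k ↦ E.f (x.1 k).1) k = (x.1 k).2 :=
  WidePullback.lift_π _ _ _ _ _

lemma toFibreProduct_base {n : ℕ} {V : Cᵒᵖ} (x : (nerve E n).obj V)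
    [HasWidePullback U (fun k ↦ E.X (x.1 k).1) (fun k ↦ E.f (x.1 k).1)] :
    toFibreProduct x ≫ WidePullback.base (fun k ↦ E.f (x.1 k).1) = (x.1 0).2 ≫ E.f (x.1 0).1 :=
  WidePullback.lift_base _ _ _ _

/-- If the fibre products `X i₀ ×_U ⋯ ×_U X iₙ` exist, then the Čech `n`-cochains with values in `P`
are the families of sections of `P` over these fibre products. -/
def cochainEquiv (n : ℕ)
    [∀ i : Fin (n + 1) → E.I₀, HasWidePullback U (fun k ↦ E.X (i k)) (fun k ↦ E.f (i k))]
    (P : Cᵒᵖ ⥤ Ab.{u}) : ((cechRes E).X n ⟶ P) ≃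
      ∀ i : Fin (n + 1) → E.I₀, P.obj (op (fibreProduct i)) where
  toFun a i := value a (projections i)
  invFun t := (freeAdj.homEquiv (nerve E n) P).symm
    { app V := TypeCat.ofHom fun x ↦ P.map (toFibreProduct x).op (t fun k ↦ (x.1 k).1)
      naturality V W f := by
        ext x
        have h₁ (k) : (f.unop ≫ toFibreProduct x) ≫ WidePullback.π (fun k ↦ E.f (x.1 k).1) k =
            f.unop ≫ (x.1 k).2 := by
          rw [Category.assoc, toFibreProduct_π]
        have h₂ : (f.unop ≫ toFibreProduct x) ≫ WidePullback.base (fun k ↦ E.f (x.1 k).1) =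
            (f.unop ≫ (x.1 0).2) ≫ E.f (x.1 0).1 := by
          rw [Category.assoc, toFibreProduct_base, Category.assoc]
        have h : toFibreProduct ((nerve E n).map f x) = f.unop ≫ toFibreProduct x :=
          WidePullback.hom_ext _ _ _
            (fun k ↦ (WidePullback.lift_π _ _ _ _ _).trans (h₁ k).symm)
            ((WidePullback.lift_base _ _ _ _).trans h₂.symm)
        change P.map (toFibreProduct ((nerve E n).map f x)).op (t fun k ↦ (x.1 k).1) =
          P.map f (P.map (toFibreProduct x).op (t fun k ↦ (x.1 k).1))
        rw [h]
        exact congrArg (fun g ↦ g.hom (t fun k ↦ (x.1 k).1)) (P.map_comp (toFibreProduct x).op f) }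
  left_inv a := ext_value fun V x ↦ by
    rw [value_homEquiv_symm]
    change P.map (toFibreProduct x).op (value a (projections fun k ↦ (x.1 k).1)) = _
    rw [← value_map]
    congr 1
    refine Subtype.ext (funext fun k ↦ Sigma.ext rfl (heq_of_eq ?_))
    exact WidePullback.lift_π _ _ _ _ _
  right_inv t := by
    funext i
    refine (value_homEquiv_symm _ _).trans ?_
    change P.map (toFibreProduct (projections i)).op (t i) = t i
    have h : toFibreProduct (projections i) = 𝟙 (fibreProduct i) :=
      WidePullback.hom_ext _ _ _
        (fun k ↦ (WidePullback.lift_π _ _ _ _ _).trans (Category.id_comp _).symm)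
        ((WidePullback.lift_base _ _ _ _).trans (by simp [projections]))
    rw [h]
    exact congrArg (fun g ↦ g.hom (t i)) (P.map_id (op (fibreProduct i)))

end Cocycles

end

end CechCup

/-! Both products can be computed by dimension shifting in the second variable. The derived product
of `x : K ⟶ A[r]` and `y : L ⟶ B[s]` uses a factorization of `y` into `κ ∈ Extˢ(L, M)`, with `M`
flat, and `g : M ⟶ B`, and is the composition of `K ⊗ κ`, `x ⊗ M` and `A ⊗ g`. By `derivedTensor_eq`
every such factorization gives the same result. For a Čech `s`-cocycle `b` there is a natural one:
`M` is the `s`-th syzygy of `ℤ[S]` in the Čech resolution, flat because it is torsion free, `κ` is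
the class of the truncated resolution, and `g` is induced by `b`.

On the other side, the class of `a ∪ b` is computed by splitting `s` extension classes off the Čech
resolution. The Alexander–Whitney components `(0, j)`, followed by `ε` on the first factor, form a
chain map `ℤ[N_•] ⟶ ℤ[S] ⊗ ℤ[N_•]` over the diagonal, which turns these extension classes into `K ⊗
κ`. The components `(i, s)`, followed by the projection to the syzygy on the second factor, form a
morphism of resolutions from what remains of `ℤ[N_•]` to `ℤ[N_•] ⊗ M`, which turns the remaining
class into `x ⊗ M`. The Leibniz rule enters without a sign: its sign is `(-1)⁰` for the first
family, and it multiplies a vanishing term for the second. This is `exists_tensorVia_classHom`, and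
`toExt_cechCup` is its application.

Sheafification is exact, monoidal and preserves torsion free objects, so it commutes with the
derived tensor product (`mapExactFunctor_derivedTensor`). Together with `derivedTensor_naturality`
and the isomorphism of the sheaf associated with `ℤ[S]` with `ℤ_U`, this gives `edge_presheafCup`.
The statement for the limit follows, since two Čech classes are always represented on a common
covering.

In low degrees, cochains with values in a sheaf are cochains on the sheafified Čech resolution
(`edge_classHom`). For any resolution, `classHom` is injective modulo coboundaries in degrees `0`
and `1`; it is onto in degree `0`, and in degree `1` it reaches every class that dies on `X 0`. A
class in `H¹(U, F)` is killed by some epimorphism onto `ℤ_U`, along which the canonical section of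
`ℤ_U` lifts locally (`exists_local_lift`), so it dies on the term `X 0` of a suitable covering. -/

namespace CechCup

noncomputable section

/-! ### Exact functors on `Ext`: naturality and composition. -/

section ExactFunctors

universe w' v' u' w'' v'' u''

variable {𝒜 : Type u} [Category.{v} 𝒜] [Abelian 𝒜] [HasExt.{w} 𝒜]
  {ℬ : Type u'} [Category.{v'} ℬ] [Abelian ℬ] [HasExt.{w'} ℬ]
  {𝒟 : Type u''} [Category.{v''} 𝒟] [Abelian 𝒟] [HasExt.{w''} 𝒟]

/-- An embedding of `A` into an injective object effaces positive degree classes. This reduces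
statements about multiplicative operations on `Ext` to degree zero and to extension classes. The
equality `e` lets callers eliminate `A` in favour of the variable `S.X₁`. -/
lemma exists_comp_extClass [EnoughInjectives 𝒜] {K A : 𝒜} {n : ℕ} (x : Ext.{w} K A (n + 1)) :
    ∃ (S : ShortComplex 𝒜) (hS : S.ShortExact) (e : S.X₁ = A) (y : Ext.{w} K S.X₃ n),
      x = e ▸ y.comp hS.extClass rfl := by
  let S : ShortComplex 𝒜 := ShortComplex.mk (Injective.ι A) (cokernel.π (Injective.ι A))
    (cokernel.condition _)
  have hS : S.ShortExact := { exact := ShortComplex.exact_cokernel _ }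
  obtain ⟨y, hy⟩ := Ext.covariant_sequence_exact₁ K hS x (Ext.eq_zero_of_injective _)
    (n₀ := n) rfl
  exact ⟨S, hS, rfl, y, hy.symm⟩

/-- The maps on `Ext` induced by exact functors are natural in the functor. -/
lemma mapExactFunctor_naturality [EnoughInjectives 𝒜] (F G : 𝒜 ⥤ ℬ) [F.Additive] [G.Additive]
    [PreservesFiniteLimits F] [PreservesFiniteColimits F]
    [PreservesFiniteLimits G] [PreservesFiniteColimits G] (τ : F ⟶ G) {K A : 𝒜} :
    ∀ {n : ℕ} (x : Ext.{w} K A n),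
      (x.mapExactFunctor F : Ext.{w'} _ _ n).comp (Ext.mk₀ (τ.app A)) (add_zero n) =
        (Ext.mk₀ (τ.app K)).comp (x.mapExactFunctor G) (zero_add n) := by
  intro n
  induction n generalizing A with
  | zero =>
    intro x
    obtain ⟨f, rfl⟩ := (Ext.mk₀_bijective _ _).2 x
    rw [Ext.mapExactFunctor_mk₀, Ext.mapExactFunctor_mk₀, Ext.mk₀_comp_mk₀, Ext.mk₀_comp_mk₀,
      τ.naturality]
  | succ n ih =>
    intro x
    obtain ⟨S, hS, rfl, y, rfl⟩ := exists_comp_extClass x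
    have h : (hS.extClass.mapExactFunctor F : Ext.{w'} _ _ 1).comp (Ext.mk₀ (τ.app S.X₁))
        (add_zero 1) = (Ext.mk₀ (τ.app S.X₃)).comp (hS.extClass.mapExactFunctor G) (zero_add 1) := by
      rw [Ext.mapExactFunctor_extClass, Ext.mapExactFunctor_extClass]
      exact ShortComplex.ShortExact.extClass_naturality (hS.map_of_exact F) (hS.map_of_exact G)
        (S.mapNatTrans τ)
    -- This clears the trivial transport left by the substitution of `S.X₁` for `A`.
    dsimp only
    rw [Ext.mapExactFunctor_comp, Ext.mapExactFunctor_comp,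
      Ext.comp_assoc (a₂₃ := 1) _ _ _ rfl (by lia) (by lia), h,
      ← Ext.comp_assoc (a₁₂ := n) _ _ _ (by lia) (by lia) (by lia), ih,
      Ext.comp_assoc (a₂₃ := n + 1) _ _ _ (by lia) (by lia) (by lia)]

/-- The map on `Ext` induced by a composition of exact functors. -/
lemma mapExactFunctor_mapExactFunctor [EnoughInjectives 𝒜] (F : 𝒜 ⥤ ℬ) (G : ℬ ⥤ 𝒟)
    [F.Additive] [G.Additive]
    [PreservesFiniteLimits F] [PreservesFiniteColimits F]
    [PreservesFiniteLimits G] [PreservesFiniteColimits G]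
    [(F ⋙ G).Additive] [PreservesFiniteLimits (F ⋙ G)] [PreservesFiniteColimits (F ⋙ G)]
    {K A : 𝒜} : ∀ {n : ℕ} (x : Ext.{w} K A n),
      ((x.mapExactFunctor F : Ext.{w'} _ _ n).mapExactFunctor G : Ext.{w''} _ _ n) =
        x.mapExactFunctor (F ⋙ G) := by
  intro n
  induction n generalizing A with
  | zero =>
    intro x
    obtain ⟨f, rfl⟩ := (Ext.mk₀_bijective _ _).2 x
    rw [Ext.mapExactFunctor_mk₀, Ext.mapExactFunctor_mk₀, Ext.mapExactFunctor_mk₀]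
    rfl
  | succ n ih =>
    intro x
    obtain ⟨S, hS, rfl, y, rfl⟩ := exists_comp_extClass x
    -- An exact functor takes an extension class to that of the image sequence, and the two ways of
    -- forming the image sequence agree.
    have h : (hS.extClass.mapExactFunctor F : Ext.{w'} _ _ 1).mapExactFunctor G =
        (hS.extClass.mapExactFunctor (F ⋙ G) : Ext.{w''} _ _ 1) := by
      rw [Ext.mapExactFunctor_extClass, Ext.mapExactFunctor_extClass]
      exact Ext.mapExactFunctor_extClass G (hS.map_of_exact F)
    dsimp only
    rw [Ext.mapExactFunctor_comp, Ext.mapExactFunctor_comp, Ext.mapExactFunctor_comp, h, ih]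

end ExactFunctors

/-! ### The tensor product of `Ext` classes along a flat factorization. -/

section DerivedTensor

variable {𝒜 : Type u} [Category.{v} 𝒜] [Abelian 𝒜] [HasExt.{w} 𝒜] [MonoidalCategory 𝒜]

/-- The exact functor `M ⊗ -` on `Ext`, for a flat object `M`. -/
abbrev extWhiskerLeft (M : 𝒜) [FlatObject M] {K A : 𝒜} {n : ℕ} (x : Ext.{w} K A n) :
    Ext.{w} (M ⊗ K) (M ⊗ A) n := x.mapExactFunctor (tensorLeft M)

/-- The exact functor `- ⊗ M` on `Ext`, for a flat object `M`. -/
abbrev extWhiskerRight (M : 𝒜) [FlatObject M] {K A : 𝒜} {n : ℕ} (x : Ext.{w} K A n) :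
    Ext.{w} (K ⊗ M) (A ⊗ M) n := x.mapExactFunctor (tensorRight M)

section

variable {M N : 𝒜} [FlatObject M] [FlatObject N] {K A B : 𝒜}

lemma extWhiskerLeft_mk₀ (f : K ⟶ A) :
    extWhiskerLeft M (Ext.mk₀ f : Ext.{w} K A 0) = Ext.mk₀ (M ◁ f) :=
  Ext.mapExactFunctor_mk₀ _ _

lemma extWhiskerRight_mk₀ (f : K ⟶ A) :
    extWhiskerRight M (Ext.mk₀ f : Ext.{w} K A 0) = Ext.mk₀ (f ▷ M) :=
  Ext.mapExactFunctor_mk₀ _ _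

lemma extWhiskerLeft_comp {a b c : ℕ} (x : Ext.{w} K A a) (y : Ext.{w} A B b) (h : a + b = c) :
    extWhiskerLeft M (x.comp y h) = (extWhiskerLeft M x).comp (extWhiskerLeft M y) h :=
  Ext.mapExactFunctor_comp _ _ _ _

lemma extWhiskerRight_comp {a b c : ℕ} (x : Ext.{w} K A a) (y : Ext.{w} A B b) (h : a + b = c) :
    extWhiskerRight M (x.comp y h) = (extWhiskerRight M x).comp (extWhiskerRight M y) h :=
  Ext.mapExactFunctor_comp _ _ _ _

/-- A morphism `f` is a natural transformation between the exact functors `- ⊗ M` and `- ⊗ N`, so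
the interchange law extends from morphisms to `Ext` classes. -/
lemma extWhiskerRight_exchange [EnoughInjectives 𝒜] (f : M ⟶ N) {n : ℕ} (x : Ext.{w} K A n) :
    (extWhiskerRight M x).comp (Ext.mk₀ (A ◁ f)) (add_zero n) =
      (Ext.mk₀ (K ◁ f)).comp (extWhiskerRight N x) (zero_add n) :=
  mapExactFunctor_naturality (tensorRight M) (tensorRight N)
    { app X := X ◁ f, naturality _ _ g := (whisker_exchange g f).symm } x

lemma extWhiskerLeft_exchange [EnoughInjectives 𝒜] (f : M ⟶ N) {n : ℕ} (x : Ext.{w} K A n) :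
    (extWhiskerLeft M x).comp (Ext.mk₀ (f ▷ A)) (add_zero n) =
      (Ext.mk₀ (f ▷ K)).comp (extWhiskerLeft N x) (zero_add n) :=
  mapExactFunctor_naturality (tensorLeft M) (tensorLeft N)
    { app X := f ▷ X, naturality _ _ g := whisker_exchange f g } x

end

/-- The composition `K ⊗ L ⟶ (K ⊗ M)[s] ⟶ (A ⊗ M)[r + s] ⟶ (A ⊗ B)[r + s]` defined by classes
`x ∈ Extʳ(K, A)` and `κ ∈ Extˢ(L, M)` and a morphism `g : M ⟶ B`, for flat objects `K` and `M`. -/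
def tensorVia {K L A B M : 𝒜} [FlatObject K] [FlatObject M] {r s : ℕ} (x : Ext.{w} K A r)
    (κ : Ext.{w} L M s) (g : M ⟶ B) : Ext.{w} (K ⊗ L) (A ⊗ B) (r + s) :=
  ((extWhiskerLeft K κ).comp (extWhiskerRight M x) (Nat.add_comm s r)).comp (Ext.mk₀ (A ◁ g))
    (add_zero (r + s))

variable {K L A B M N : 𝒜} [FlatObject K] [FlatObject M] [FlatObject N] {r s : ℕ}

/-- Morphisms between flat intermediate objects slide from `κ` to `g`, as they commute with `x` by
interchange. Along with additivity in `κ`, this is the relation from which independence of the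
factorization is derived. -/
lemma tensorVia_mk₀_comp [EnoughInjectives 𝒜] (x : Ext.{w} K A r) (κ : Ext.{w} L N s) (i : N ⟶ M)
    (g : M ⟶ B) :
    tensorVia x (κ.comp (Ext.mk₀ i) (add_zero s)) g = tensorVia x κ (i ≫ g) := by
  rw [tensorVia, tensorVia, extWhiskerLeft_comp, extWhiskerLeft_mk₀, MonoidalCategory.whiskerLeft_comp,
    ← Ext.mk₀_comp_mk₀, Ext.comp_assoc_of_second_deg_zero, ← extWhiskerRight_exchange,
    ← Ext.comp_assoc_of_third_deg_zero, ← Ext.comp_assoc (a₁₂ := r + s) (a₂₃ := 0) _ _ _ (by lia) (by lia) (by lia)]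

lemma tensorVia_zero (x : Ext.{w} K A r) (g : M ⟶ B) : tensorVia x (0 : Ext.{w} L M s) g = 0 := by
  simp [tensorVia, extWhiskerLeft]

lemma tensorVia_add (x : Ext.{w} K A r) (κ κ' : Ext.{w} L M s) (g : M ⟶ B) :
    tensorVia x (κ + κ') g = tensorVia x κ g + tensorVia x κ' g := by
  simp [tensorVia, extWhiskerLeft]

end DerivedTensor

/-! ### Independence of the flat factorization, and naturality. -/

section Independence

variable {𝒜 : Type u} [Category.{v} 𝒜] [Abelian 𝒜]

lemma TorsionFree.biprod {M N : 𝒜} (hM : TorsionFree M) (hN : TorsionFree N) :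
    TorsionFree (M ⊞ N) := fun n hn ↦ by
  have := hM n hn
  have := hN n hn
  refine Preadditive.mono_of_cancel_zero _ fun f hf ↦ ?_
  have hf' : n • f = 0 := by simpa using hf
  refine biprod.hom_ext _ _ ?_ ?_
  · rw [← cancel_mono (n • 𝟙 M)]
    simp [← Preadditive.zsmul_comp, hf']
  · rw [← cancel_mono (n • 𝟙 N)]
    simp [← Preadditive.zsmul_comp, hf']

lemma TorsionFree.of_iso {M N : 𝒜} (hM : TorsionFree M) (e : N ≅ M) : TorsionFree N :=
  hM.of_mono e.hom

variable [MonoidalCategory 𝒜]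

/-- Tensoring with a flat object preserves the monomorphism `n` on the unit. The converse of torsion
free implies flat is wanted because torsion freeness, unlike flatness, visibly passes to subobjects.
-/
lemma FlatObject.torsionFree (hI : TorsionFree (𝟙_ 𝒜)) (M : 𝒜) [FlatObject M] :
    TorsionFree M := by
  refine TorsionFree.of_iso (M := M ⊗ 𝟙_ 𝒜) (fun n hn ↦ ?_) (ρ_ M).symm
  have := hI n hn
  have h : (tensorLeft M).map (n • 𝟙 (𝟙_ 𝒜)) = n • 𝟙 (M ⊗ 𝟙_ 𝒜) := by
    rw [Functor.map_zsmul, CategoryTheory.Functor.map_id]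
    rfl
  rw [← h]
  infer_instance

variable [HasTorsionFreeCovers 𝒜]

/-- The functor `A ⊗ -` is not assumed additive. A flat cover `P` of `A` reduces the claim to the
additive functor `P ⊗ -`, because `P ⊗ M ⟶ A ⊗ M` is an epimorphism for flat `M`. -/
lemma whiskerLeft_zero {A M B : 𝒜} [FlatObject M] : A ◁ (0 : M ⟶ B) = 0 := by
  obtain ⟨P, p, hP, hp⟩ := HasTorsionFreeCovers.cover A
  have := HasTorsionFreeCovers.flat P hP
  have : Epi (p ▷ M) := inferInstanceAs (Epi ((tensorRight M).map p))
  have h : P ◁ (0 : M ⟶ B) = 0 := (tensorLeft P).map_zero M B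
  rw [← cancel_epi (p ▷ M), ← whisker_exchange, h, zero_comp, comp_zero]

variable [HasExt.{w} 𝒜] [EnoughInjectives 𝒜]

/-- Adding a torsion free cover of `B` to `M` makes `g` an epimorphism `q` without changing the
product. The kernel of `q` is again flat, and `κ` lifts to it because its image in `Extˢ(L, B)` is
zero. Sliding the inclusion of the kernel past `x` then leaves the morphism `kernel.ι q ≫ q = 0`. -/
lemma tensorVia_eq_zero {K L A B M : 𝒜} [FlatObject K] [FlatObject M] (hM : TorsionFree M)
    {r s : ℕ} (x : Ext.{w} K A r) (κ : Ext.{w} L M s) (g : M ⟶ B)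
    (h : κ.comp (Ext.mk₀ g) (add_zero s) = 0) : tensorVia x κ g = 0 := by
  obtain ⟨P, p, hP, hp⟩ := HasTorsionFreeCovers.cover B
  let q : M ⊞ P ⟶ B := biprod.desc g p
  have : Epi (biprod.inr ≫ q) := by rwa [biprod.inr_desc]
  have : Epi q := epi_of_epi biprod.inr q
  let S : ShortComplex 𝒜 := ShortComplex.mk (kernel.ι q) q (kernel.condition _)
  have hS : S.ShortExact := { exact := ShortComplex.exact_kernel _ }
  have hMP := hM.biprod hP
  have := HasTorsionFreeCovers.flat _ hMP
  have : FlatObject (kernel q) := HasTorsionFreeCovers.flat _ (hMP.of_mono (kernel.ι q))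
  obtain ⟨κ', hκ'⟩ := Ext.covariant_sequence_exact₂ L hS
    (κ.comp (Ext.mk₀ (biprod.inl : M ⟶ M ⊞ P)) (add_zero s)) (by
      rw [Ext.comp_assoc_of_third_deg_zero, Ext.mk₀_comp_mk₀, biprod.inl_desc, h])
  have hg : biprod.inl ≫ q = g := biprod.inl_desc _ _
  rw [← hg, ← tensorVia_mk₀_comp, ← hκ', tensorVia_mk₀_comp, kernel.condition, tensorVia,
    whiskerLeft_zero, Ext.mk₀_zero, Ext.comp_zero]

/-- The difference of two factorizations of the same class is a factorization of zero through `M ⊞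
M'`. -/
lemma tensorVia_congr {K L A B M M' : 𝒜} [FlatObject K] [FlatObject M] [FlatObject M']
    (hI : TorsionFree (𝟙_ 𝒜)) {r s : ℕ} (x : Ext.{w} K A r) (κ : Ext.{w} L M s) (g : M ⟶ B)
    (κ' : Ext.{w} L M' s) (g' : M' ⟶ B)
    (h : κ.comp (Ext.mk₀ g) (add_zero s) = κ'.comp (Ext.mk₀ g') (add_zero s)) :
    tensorVia x κ g = tensorVia x κ' g' := by
  have hM := (FlatObject.torsionFree hI M).biprod (FlatObject.torsionFree hI M')
  have := HasTorsionFreeCovers.flat _ hM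
  have h₀ := tensorVia_eq_zero hM x (κ.comp (Ext.mk₀ biprod.inl) (add_zero s) +
    (-κ').comp (Ext.mk₀ biprod.inr) (add_zero s)) (biprod.desc g g') (by
      simp [h])
  have hneg : tensorVia x (-κ') g' = -tensorVia x κ' g' := by
    rw [eq_neg_iff_add_eq_zero, ← tensorVia_add, neg_add_cancel, tensorVia_zero]
  rwa [tensorVia_add, tensorVia_mk₀_comp, tensorVia_mk₀_comp, biprod.inl_desc, biprod.inr_desc,
    hneg, add_neg_eq_zero] at h₀

/-- The derived tensor product does not depend on the factorization used to compute it. -/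
lemma derivedTensor_eq {K L A B M : 𝒜} [FlatObject M] (hI : TorsionFree (𝟙_ 𝒜))
    (hK : TorsionFree K) (hL : TorsionFree L) {r s : ℕ} (x : Ext.{w} K A r) (κ : Ext.{w} L M s)
    (g : M ⟶ B) :
    derivedTensor hK hL x (κ.comp (Ext.mk₀ g) (add_zero s)) =
      (have := HasTorsionFreeCovers.flat K hK; tensorVia x κ g) := by
  have := HasTorsionFreeCovers.flat K hK
  let F := (exists_flatFactorization s hL (κ.comp (Ext.mk₀ g) (add_zero s))).some
  have := F.flat
  exact tensorVia_congr hI x F.κ F.g κ g F.fac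

/-- A factorization of `y` through `M` gives one of the modified class through the same `M`. By
independence both sides may be computed with it, and what is left is interchange. -/
lemma derivedTensor_naturality (hI : TorsionFree (𝟙_ 𝒜)) {K L K' L' A B A' B' : 𝒜}
    (hK : TorsionFree K) (hL : TorsionFree L) (hK' : TorsionFree K') (hL' : TorsionFree L')
    (k : K' ⟶ K) (l : L' ⟶ L) (α : A ⟶ A') (β : B ⟶ B') {r s : ℕ} (x : Ext.{w} K A r)
    (y : Ext.{w} L B s) :
    derivedTensor hK' hL' ((Ext.mk₀ k).comp (x.comp (Ext.mk₀ α) (add_zero r)) (zero_add r))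
        ((Ext.mk₀ l).comp (y.comp (Ext.mk₀ β) (add_zero s)) (zero_add s)) =
      (Ext.mk₀ (k ⊗ₘ l)).comp ((derivedTensor hK hL x y).comp (Ext.mk₀ (α ⊗ₘ β)) (add_zero _))
        (zero_add _) := by
  obtain ⟨M, hM, κ, g, rfl⟩ := exists_flatFactorization s hL y
  have := HasTorsionFreeCovers.flat K hK
  have := HasTorsionFreeCovers.flat K' hK'
  have e : (Ext.mk₀ l).comp ((κ.comp (Ext.mk₀ g) (add_zero s)).comp (Ext.mk₀ β) (add_zero s))
      (zero_add s) = ((Ext.mk₀ l).comp κ (zero_add s)).comp (Ext.mk₀ (g ≫ β)) (add_zero s) := by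
    simp only [Ext.comp_assoc_of_third_deg_zero, Ext.mk₀_comp_mk₀]
  rw [e, derivedTensor_eq hI, derivedTensor_eq hI]
  simp only [tensorVia, extWhiskerLeft_comp, extWhiskerRight_comp, extWhiskerLeft_mk₀,
    extWhiskerRight_mk₀]
  have e₁ : k ⊗ₘ l = K' ◁ l ≫ k ▷ L := MonoidalCategory.tensorHom_def' k l
  have e₂ : A ◁ g ≫ (α ⊗ₘ β) = α ▷ M ≫ A' ◁ (g ≫ β) := by
    rw [MonoidalCategory.tensorHom_def, whisker_exchange_assoc, MonoidalCategory.whiskerLeft_comp]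
  have e₃ := extWhiskerLeft_exchange k κ
  simp only [Ext.comp_assoc_of_third_deg_zero, Ext.mk₀_comp_mk₀, e₁, e₂]
  rw [← Ext.mk₀_comp_mk₀_assoc, ← Ext.mk₀_comp_mk₀,
    ← Ext.comp_assoc (a₁₂ := s) (Ext.mk₀ (k ▷ L)) (extWhiskerLeft K κ) _ (by lia) (by lia) (by lia),
    ← e₃, Ext.comp_assoc (a₁₂ := s) (a₂₃ := r) (extWhiskerLeft K' κ) _ _ (by lia) (by lia) (by lia),
    Ext.comp_assoc (a₁₂ := s) (a₂₃ := r + s) (Ext.mk₀ (K' ◁ l)) _ _ (by lia) (by lia) (by lia),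
    ← Ext.comp_assoc_of_third_deg_zero (extWhiskerRight M x),
    ← Ext.comp_assoc (a₁₂ := r) (a₂₃ := r) (Ext.mk₀ (k ▷ M)) _ _ (by lia) (by lia) (by lia)]

end Independence

/-! ### Compatibility of the derived tensor product with exact oplax monoidal functors. -/

section Monoidal

universe w' v' u'

variable {𝒜 : Type u} [Category.{v} 𝒜] [Abelian 𝒜] [HasExt.{w} 𝒜] [EnoughInjectives 𝒜]
  [MonoidalCategory 𝒜]
  {ℬ : Type u'} [Category.{v'} ℬ] [Abelian ℬ] [HasExt.{w'} ℬ]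
  [MonoidalCategory ℬ] (G : 𝒜 ⥤ ℬ) [G.Additive]
  [PreservesFiniteLimits G] [PreservesFiniteColimits G] [G.OplaxMonoidal]

/-- With one variable fixed, `δ` is a natural transformation between the exact functors `G(M ⊗ -)`
and `G(M) ⊗ G(-)`. Its invertibility plays no role. -/
lemma mapExactFunctor_extWhiskerLeft (M : 𝒜) [FlatObject M] [FlatObject (G.obj M)] {K A : 𝒜}
    {n : ℕ} (x : Ext.{w} K A n) :
    ((extWhiskerLeft M x).mapExactFunctor G : Ext.{w'} _ _ n).comp
        (Ext.mk₀ (Functor.OplaxMonoidal.δ G M A)) (add_zero n) =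
      (Ext.mk₀ (Functor.OplaxMonoidal.δ G M K)).comp
        (extWhiskerLeft (G.obj M) (x.mapExactFunctor G)) (zero_add n) := by
  have := comp_preservesFiniteLimits (tensorLeft M) G
  have := comp_preservesFiniteColimits (tensorLeft M) G
  have := comp_preservesFiniteLimits G (tensorLeft (G.obj M))
  have := comp_preservesFiniteColimits G (tensorLeft (G.obj M))
  rw [extWhiskerLeft, extWhiskerLeft, mapExactFunctor_mapExactFunctor,
    mapExactFunctor_mapExactFunctor]
  exact mapExactFunctor_naturality (tensorLeft M ⋙ G) (G ⋙ tensorLeft (G.obj M))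
    { app X := Functor.OplaxMonoidal.δ G M X
      naturality _ _ f := (Functor.OplaxMonoidal.δ_natural_right G M f).symm } x

lemma mapExactFunctor_extWhiskerRight (M : 𝒜) [FlatObject M] [FlatObject (G.obj M)] {K A : 𝒜}
    {n : ℕ} (x : Ext.{w} K A n) :
    ((extWhiskerRight M x).mapExactFunctor G : Ext.{w'} _ _ n).comp
        (Ext.mk₀ (Functor.OplaxMonoidal.δ G A M)) (add_zero n) =
      (Ext.mk₀ (Functor.OplaxMonoidal.δ G K M)).comp
        (extWhiskerRight (G.obj M) (x.mapExactFunctor G)) (zero_add n) := by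
  have := comp_preservesFiniteLimits (tensorRight M) G
  have := comp_preservesFiniteColimits (tensorRight M) G
  have := comp_preservesFiniteLimits G (tensorRight (G.obj M))
  have := comp_preservesFiniteColimits G (tensorRight (G.obj M))
  rw [extWhiskerRight, extWhiskerRight, mapExactFunctor_mapExactFunctor,
    mapExactFunctor_mapExactFunctor]
  exact mapExactFunctor_naturality (tensorRight M ⋙ G) (G ⋙ tensorRight (G.obj M))
    { app X := Functor.OplaxMonoidal.δ G X M
      naturality _ _ f := (Functor.OplaxMonoidal.δ_natural_left G f M).symm } x

lemma mapExactFunctor_tensorVia {K L A B M : 𝒜} [FlatObject K] [FlatObject M]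
    [FlatObject (G.obj K)] [FlatObject (G.obj M)] {r s : ℕ} (x : Ext.{w} K A r)
    (κ : Ext.{w} L M s) (g : M ⟶ B) :
    ((tensorVia x κ g).mapExactFunctor G : Ext.{w'} _ _ _).comp
        (Ext.mk₀ (Functor.OplaxMonoidal.δ G A B)) (add_zero _) =
      (Ext.mk₀ (Functor.OplaxMonoidal.δ G K L)).comp
        (tensorVia (x.mapExactFunctor G) (κ.mapExactFunctor G) (G.map g)) (zero_add _) := by
  simp only [tensorVia, Ext.mapExactFunctor_comp, Ext.mapExactFunctor_mk₀]
  rw [Ext.comp_assoc_of_third_deg_zero, Ext.mk₀_comp_mk₀,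
    ← Functor.OplaxMonoidal.δ_natural_right, ← Ext.mk₀_comp_mk₀,
    ← Ext.comp_assoc_of_third_deg_zero,
    Ext.comp_assoc_of_third_deg_zero (Ext.mapExactFunctor G (extWhiskerLeft K κ)),
    mapExactFunctor_extWhiskerRight,
    ← Ext.comp_assoc_of_second_deg_zero, mapExactFunctor_extWhiskerLeft,
    Ext.comp_assoc (a₁₂ := s) (a₂₃ := r + s) _ _ _ (by lia) (by lia) (by lia),
    Ext.comp_assoc_of_third_deg_zero]

/-- The image under `G` of a flat factorization is again a flat factorization: the intermediate
object is torsion free by `hI`, remains so by `hG`, and is therefore flat in `ℬ`. It need not be the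
one chosen in `ℬ`, hence `derivedTensor_eq` there as well. -/
lemma mapExactFunctor_derivedTensor [EnoughInjectives ℬ] [HasTorsionFreeCovers 𝒜] [HasTorsionFreeCovers ℬ]
    (hI : TorsionFree (𝟙_ 𝒜)) (hI' : TorsionFree (𝟙_ ℬ))
    (hG : ∀ M : 𝒜, TorsionFree M → TorsionFree (G.obj M)) {K L A B : 𝒜} (hK : TorsionFree K)
    (hL : TorsionFree L) {r s : ℕ} (x : Ext.{w} K A r) (y : Ext.{w} L B s) :
    ((derivedTensor hK hL x y).mapExactFunctor G : Ext.{w'} _ _ _).comp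
        (Ext.mk₀ (Functor.OplaxMonoidal.δ G A B)) (add_zero _) =
      (Ext.mk₀ (Functor.OplaxMonoidal.δ G K L)).comp
        (derivedTensor (hG K hK) (hG L hL) (x.mapExactFunctor G) (y.mapExactFunctor G))
          (zero_add _) := by
  obtain ⟨M, hM, κ, g, rfl⟩ := exists_flatFactorization s hL y
  have := HasTorsionFreeCovers.flat K hK
  have := HasTorsionFreeCovers.flat _ (hG K hK)
  have := HasTorsionFreeCovers.flat _ (hG M (FlatObject.torsionFree hI M))
  rw [Ext.mapExactFunctor_comp, Ext.mapExactFunctor_mk₀, derivedTensor_eq hI,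
    derivedTensor_eq hI']
  exact mapExactFunctor_tensorVia G x κ g

end Monoidal

/-! ### Naturality of the dimension-shifting homomorphism. -/

namespace Resolution

section Map

universe w' v' u'

variable {𝒜 : Type u} [Category.{v} 𝒜] [Abelian 𝒜]
  {ℬ : Type u'} [Category.{v'} ℬ] [Abelian ℬ] (G : 𝒜 ⥤ ℬ) [G.Additive]
  [PreservesFiniteLimits G] [PreservesFiniteColimits G]

/-- The image of a resolution under an exact functor. -/
def map {K : 𝒜} (R : Resolution K) : Resolution (G.obj K) where
  X n := G.obj (R.X n)
  d n := G.map (R.d n)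
  ε := G.map R.ε
  d_ε := by rw [← G.map_comp, R.d_ε, G.map_zero]
  d_d n := by rw [← G.map_comp, R.d_d, G.map_zero]
  epi := have := R.epi; inferInstance
  exact₀ := R.exact₀.map G
  exact_succ n := (R.exact_succ n).map G

/-- The image of a cocycle under an exact functor. -/
def mapCocycle {K : 𝒜} (R : Resolution K) {F : 𝒜} {n : ℕ} (a : R.cocycles F n) :
    (R.map G).cocycles (G.obj F) n :=
  ⟨G.map a.1, by
    have h : R.d n ≫ a.1 = 0 := a.2
    change G.map (R.d n) ≫ G.map a.1 = 0
    rw [← G.map_comp, h, G.map_zero]⟩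

/-- The comparison of the image of the shift of a resolution with the shift of its image. -/
def shiftMapHom {K : 𝒜} (R : Resolution K) :
    Hom (R.shift.map G) (R.map G).shift (kernelComparison R.ε G) where
  f n := 𝟙 (G.obj (R.X (n + 1)))
  comm n := (Category.id_comp _).trans (Category.comp_id _).symm
  comm_ε := by
    refine (cancel_mono (kernel.ι (R.map G).ε)).1 ?_
    change (𝟙 _ ≫ kernel.lift (G.map R.ε) (G.map (R.d 0)) (R.map G).d_ε) ≫ kernel.ι (G.map R.ε) =
      (G.map (kernel.lift R.ε (R.d 0) R.d_ε) ≫ kernelComparison R.ε G) ≫ kernel.ι (G.map R.ε)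
    rw [Category.id_comp, kernel.lift_ι, Category.assoc, kernelComparison_comp_ι, ← G.map_comp,
      kernel.lift_ι]
    exact (R.map G).d_ε

/-- An exact functor commutes with kernels only up to the isomorphism `kernelComparison`, so the
induction has to pass through the morphism `shiftMapHom` between two resolutions of different
objects. -/
lemma classHom_map [HasExt.{w} 𝒜] [HasExt.{w'} ℬ] (F : 𝒜) : ∀ (n : ℕ) {K : 𝒜} (R : Resolution K)
    (a : R.cocycles F n), ((R.map G).classHom (G.obj F) n (R.mapCocycle G a) : Ext.{w'} _ _ n) =
      (R.classHom F n a : Ext.{w} _ _ n).mapExactFunctor G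
  | 0, _, R, a => by
    rw [classHom_zero, classHom_zero, Ext.mapExactFunctor_mk₀]
    congr 1
    have := (R.map G).epi
    rw [← cancel_epi (R.map G).ε, ε_desc₀]
    change G.map a.1 = G.map R.ε ≫ G.map _
    rw [← G.map_comp, ε_desc₀]
  | n + 1, _, R, a => by
    have h : (R.head_shortExact.extClass.mapExactFunctor G : Ext.{w'} _ _ 1).comp
        (Ext.mk₀ (kernelComparison R.ε G)) (add_zero 1) = (R.map G).head_shortExact.extClass := by
      rw [Ext.mapExactFunctor_extClass]
      have := ShortComplex.ShortExact.extClass_naturality (R.head_shortExact.map_of_exact G)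
        (R.map G).head_shortExact
        { τ₁ := kernelComparison R.ε G, τ₂ := 𝟙 (G.obj (R.X 0)), τ₃ := 𝟙 _,
          comm₁₂ := (kernelComparison_comp_ι R.ε G).trans (Category.comp_id _).symm,
          comm₂₃ := (Category.id_comp _).trans (Category.comp_id _).symm }
      exact this.trans (Ext.mk₀_id_comp _)
    -- The comparison is the identity in every degree; only the augmentations differ.
    have e : (R.shiftMapHom G).mapCocycles (G.obj F) n
        ((R.map G).shiftCocycles _ n (R.mapCocycle G a)) =
          R.shift.mapCocycle G (R.shiftCocycles F n a) :=
      Subtype.ext (Category.id_comp _)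
    have key := Hom.classHom_mapCocycles (G.obj F) n (R.shiftMapHom G)
      ((R.map G).shiftCocycles _ n (R.mapCocycle G a))
    rw [e] at key
    rw [classHom_succ, classHom_succ, Ext.mapExactFunctor_comp, ← classHom_map F n R.shift, key]
    refine Eq.trans ?_ (Ext.comp_assoc (a₁₂ := 1) _ _ _ (by lia) (by lia) (by lia))
    exact (congrArg (fun z ↦ Ext.comp z _ _) h).symm

end Map

variable {𝒜 : Type u} [Category.{v} 𝒜] [Abelian 𝒜]

/-- The cocycle `b` is a separate argument tied to `a` by an equation, so that the induction
hypothesis applies directly to the shifted cocycles. -/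
lemma classHom_comp [HasExt.{w} 𝒜] {F F' : 𝒜} (φ : F ⟶ F') : ∀ (n : ℕ) {K : 𝒜} (R : Resolution K)
    (a : R.cocycles F n) (b : R.cocycles F' n), a.1 ≫ φ = b.1 →
      R.classHom F' n b = (R.classHom F n a : Ext.{w} _ _ n).comp (Ext.mk₀ φ) (add_zero n)
  | 0, _, R, a, b, h => by
    rw [classHom_zero, classHom_zero, Ext.mk₀_comp_mk₀]
    congr 1
    have := R.epi
    rw [← cancel_epi R.ε, ε_desc₀, ← Category.assoc, ε_desc₀, h]
  | n + 1, _, R, a, b, h => by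
    rw [classHom_succ, classHom_succ, Ext.comp_assoc_of_third_deg_zero,
      classHom_comp φ n R.shift (R.shiftCocycles F n a) (R.shiftCocycles F' n b) h]

lemma toExt_mapCoeff [HasExt.{w} 𝒜] {K : 𝒜} (R : Resolution K) {F F' : 𝒜} (φ : F ⟶ F') (n : ℕ)
    (x : R.Cohomology F n) :
    R.toExt F' n (R.mapCoeff φ n x) =
      (R.toExt F n x : Ext.{w} _ _ n).comp (Ext.mk₀ φ) (add_zero n) := by
  obtain ⟨a, rfl⟩ := QuotientAddGroup.mk_surjective x
  exact R.classHom_comp φ n a _ rfl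

/-! ### Multiplicativity of dimension shifting. -/

variable [HasExt.{w} 𝒜] [MonoidalCategory 𝒜] [HasTorsionFreeCovers 𝒜]

/-- Three separate resolutions are needed because the induction on `s` shifts `R` and `R'` but
leaves `P` alone. The chain map `ψ` over `δ` peels the extension classes off `R` and `R'`
simultaneously; `φ` takes over once `s` shifts are done. Its compatibility is required only after
composition with an `f` that kills boundaries, which is what makes the sign of the Leibniz rule
invisible. The object `M` produced is the `s`-th syzygy of `L`. -/
lemma exists_tensorVia_classHom {K : 𝒜} [FlatObject K] (P : Resolution K) {A B : 𝒜} {r : ℕ}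
    (a : P.cocycles A r) :
    ∀ (s : ℕ) {D L : 𝒜} (R : Resolution D) (R' : Resolution L) (_ : TorsionFree L)
      (_ : ∀ n, TorsionFree (R'.X n)) (δ : D ⟶ K ⊗ L) (ψ : ∀ j, R.X j ⟶ K ⊗ R'.X j)
      (_ : ∀ j, ψ (j + 1) ≫ K ◁ R'.d j = R.d j ≫ ψ j) (_ : ψ 0 ≫ K ◁ R'.ε = R.ε ≫ δ)
      (φ : ∀ i n, i + s = n → (R.X n ⟶ P.X i ⊗ R'.X s))
      (_ : ∀ (i n) (h : i + s = n) (h' : i + 1 + s = n + 1) (Z : 𝒜) (f : R'.X s ⟶ Z),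
        R'.d s ≫ f = 0 → φ (i + 1) (n + 1) h' ≫ (P.d i ⊗ₘ f) = R.d n ≫ φ i n h ≫ P.X i ◁ f)
      (_ : φ 0 s (zero_add s) ≫ P.ε ▷ R'.X s = ψ s)
      (b : R'.cocycles B s) (c : R.cocycles (A ⊗ B) (r + s))
      (_ : c.1 = φ r (r + s) rfl ≫ (a.1 ⊗ₘ b.1)),
      ∃ (M : 𝒜) (_ : FlatObject M) (κ : Ext.{w} L M s) (g : M ⟶ B),
        κ.comp (Ext.mk₀ g) (add_zero s) = R'.classHom B s b ∧
        (Ext.mk₀ δ).comp (tensorVia (P.classHom A r a) κ g) (zero_add _) =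
          R.classHom (A ⊗ B) (r + s) c
  | 0, D, L, R, R', hL, hX, δ, ψ, hψ, hψε, φ, hφ, hφε, b, c, hc => by
    have := HasTorsionFreeCovers.flat L hL
    -- No extension class remains in the second variable, so `L` itself serves as the flat object.
    refine ⟨L, inferInstance, Ext.mk₀ (𝟙 L), R'.desc₀ B b, Ext.mk₀_id_comp _, ?_⟩
    -- Taking `f = R'.ε` in `hφ` makes `φ` into a morphism to the resolution `P ⊗ L` of `K ⊗ L`.
    -- Along it, `a ⊗ L` pulls back to a cocycle on `R` which becomes `c` after the coefficient map
    -- `A ⊗ b`.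
    let Φ : Hom R (P.map (tensorRight L)) δ :=
      { f n := φ n n rfl ≫ P.X n ◁ R'.ε
        comm n := by
          have h := hφ n n rfl rfl L R'.ε R'.d_ε
          rw [MonoidalCategory.tensorHom_def'] at h
          exact (Category.assoc _ _ _).trans h
        comm_ε := by
          rw [← hψε, ← hφε]
          change (φ 0 0 rfl ≫ P.X 0 ◁ R'.ε) ≫ P.ε ▷ L = _
          rw [Category.assoc, Category.assoc, whisker_exchange] }
    have h := Hom.classHom_mapCocycles (A ⊗ L) r Φ (P.mapCocycle (tensorRight L) a)
    have e := classHom_comp (A ◁ R'.desc₀ B b) r R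
      (Φ.mapCocycles (A ⊗ L) r (P.mapCocycle (tensorRight L) a)) c (by
        rw [hc]
        change ((φ r r rfl ≫ P.X r ◁ R'.ε) ≫ a.1 ▷ L) ≫ A ◁ R'.desc₀ B b = _
        rw [Category.assoc, Category.assoc, MonoidalCategory.tensorHom_def', ← R'.ε_desc₀ B b,
          MonoidalCategory.whiskerLeft_comp, Category.assoc, ← whisker_exchange]
        rfl)
    have h' := h.trans (congrArg (fun z ↦ Ext.comp (Ext.mk₀ δ) z (zero_add r))
      (classHom_map (tensorRight L) A r P a))
    refine Eq.trans ?_ e.symm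
    refine Eq.trans ?_ (congrArg (fun z ↦ Ext.comp z _ _) h').symm
    simp [tensorVia, extWhiskerLeft_mk₀]
  | s + 1, D, L, R, R', hL, hX, δ, ψ, hψ, hψε, φ, hφ, hφε, b, c, hc => by
    have hS := R'.head_shortExact.map_of_exact (tensorLeft K)
    have hm : Mono (K ◁ kernel.ι R'.ε) := hS.mono_f
    have h0 : (kernel.ι R.ε ≫ ψ 0) ≫ K ◁ R'.ε = 0 := by
      rw [Category.assoc, hψε, kernel.condition_assoc, zero_comp]
    -- Since `K` is flat, `K ⊗ kernel R'.ε` is the kernel of `K ◁ R'.ε`, and `ψ 0` restricts to the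
    -- first syzygies. This restriction is the `δ` of the next stage.
    obtain ⟨δ', hδ'⟩ : ∃ δ' : kernel R.ε ⟶ K ⊗ kernel R'.ε,
        δ' ≫ K ◁ kernel.ι R'.ε = kernel.ι R.ε ≫ ψ 0 :=
      have := hS.mono_f
      ⟨hS.exact.lift _ h0, hS.exact.lift_f _ h0⟩
    obtain ⟨M, hM, κ, g, h₁, h₂⟩ := exists_tensorVia_classHom P a s R.shift R'.shift
      ((hX 0).of_mono (kernel.ι R'.ε)) (fun n ↦ hX (n + 1)) δ' (fun j ↦ ψ (j + 1))
      (fun j ↦ hψ (j + 1)) (by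
        refine (cancel_mono (K ◁ kernel.ι R'.ε)).1 ?_
        change (ψ 1 ≫ K ◁ kernel.lift R'.ε (R'.d 0) R'.d_ε) ≫ K ◁ kernel.ι R'.ε =
          (kernel.lift R.ε (R.d 0) R.d_ε ≫ δ') ≫ K ◁ kernel.ι R'.ε
        rw [Category.assoc, Category.assoc, hδ', ← MonoidalCategory.whiskerLeft_comp,
          kernel.lift_ι, kernel.lift_ι_assoc, hψ])
      -- The shift lowers `s` and `n` together, so the morphisms and their targets `P.X i ⊗ R'.X (s
      -- + 1)` are unchanged.
      (fun i n h ↦ φ i (n + 1) (by lia)) (fun i n h h' Z f hf ↦ hφ i (n + 1) _ _ Z f hf) hφε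
      (R'.shiftCocycles B s b) (R.shiftCocycles (A ⊗ B) (r + s) c) hc
    refine ⟨M, hM, R'.head_shortExact.extClass.comp κ (Nat.add_comm 1 s), g, ?_, ?_⟩
    · rw [Ext.comp_assoc_of_third_deg_zero, h₁, classHom_succ]
    · have h := ShortComplex.ShortExact.extClass_naturality R.head_shortExact hS
        { τ₁ := δ', τ₂ := ψ 0, τ₃ := δ, comm₁₂ := hδ', comm₂₃ := hψε }
      have h' : (Ext.mk₀ δ).comp (extWhiskerLeft K R'.head_shortExact.extClass) (zero_add 1) =
          R.head_shortExact.extClass.comp (Ext.mk₀ δ') (add_zero 1) := by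
        rw [extWhiskerLeft, Ext.mapExactFunctor_extClass]
        exact h.symm
      -- The second variable acts first in `tensorVia`, so the extension class comes out on the
      -- left, where `classHom` of `R` also has it, and no sign arises.
      have e : tensorVia (P.classHom A r a) (R'.head_shortExact.extClass.comp κ (Nat.add_comm 1 s)) g =
          (extWhiskerLeft K R'.head_shortExact.extClass).comp (tensorVia (P.classHom A r a) κ g)
            (Nat.add_comm 1 (r + s)) := by
        rw [tensorVia, tensorVia, extWhiskerLeft_comp,
          ← Ext.comp_assoc_of_third_deg_zero,
          Ext.comp_assoc (a₁₂ := s + 1) (a₂₃ := r + s) _ _ _ (by lia) (by lia) (by lia)]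
      refine Eq.trans ?_ (R.classHom_succ (A ⊗ B) (r + s) c).symm
      rw [e, ← h₂, ← Ext.comp_assoc (a₁₂ := 1) _ _ _ (by lia) (by lia) (by lia)]
      refine (congrArg (fun z ↦ Ext.comp z _ _) h').trans ?_
      rw [Ext.comp_assoc (a₁₂ := 1) (a₂₃ := r + s) _ _ _ (by lia) (by lia) (by lia)]

end Resolution

/-! ### The Alexander–Whitney product as the derived product. -/

section Cech

variable {C : Type u} [SmallCategory C] {U : C} (E : PreZeroHypercover.{u} U)

lemma torsionFree_unit_presheaf : TorsionFree (𝟙_ (Cᵒᵖ ⥤ Ab.{u})) :=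
  (torsionFree_presheaf_iff _).2 fun _ ↦
    inferInstanceAs (Module.IsTorsionFree (ULift.{u} ℤ) (ULift.{u} ℤ))

lemma cupCochain_comp {r s n : ℕ} (h : r + s = n) {P P' Q Q' : Cᵒᵖ ⥤ Ab.{u}}
    (a : free.obj (nerve E r) ⟶ P) (b : free.obj (nerve E s) ⟶ Q) (f : P ⟶ P') (g : Q ⟶ Q') :
    cupCochain h a b ≫ (f ⊗ₘ g) = cupCochain h (a ≫ f) (b ≫ g) := by
  rw [cupCochain, cupCochain, Category.assoc, tensorHom_comp_tensorHom, Category.assoc,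
    Category.assoc]

/-- The product of the identity cochains is the Alexander–Whitney map `ℤ[N_n] ⟶ ℤ[N_r] ⊗ ℤ[N_s]`,
through which all cup products of cochains factor. -/
lemma cupCochain_id_comp {r s n : ℕ} (h : r + s = n) {P Q : Cᵒᵖ ⥤ Ab.{u}}
    (f : free.obj (nerve E r) ⟶ P) (g : free.obj (nerve E s) ⟶ Q) :
    cupCochain h (𝟙 _) (𝟙 _) ≫ (f ⊗ₘ g) = cupCochain h f g := by
  rw [cupCochain_comp, Category.id_comp, Category.id_comp]

/-- In the Leibniz rule the signed term contains the coboundary of `f`, which is zero. -/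
lemma cupCochain_id_naturality {s n i : ℕ} (h : i + s = n) (h' : i + 1 + s = n + 1)
    {Z : Cᵒᵖ ⥤ Ab.{u}} (f : free.obj (nerve E s) ⟶ Z) (hf : cechD E s ≫ f = 0) :
    cupCochain h' (𝟙 _) (𝟙 _) ≫ (cechD E i ⊗ₘ f) =
      cechD E n ≫ cupCochain h (𝟙 _) (𝟙 _) ≫ free.obj (nerve E i) ◁ f := by
  rw [← id_tensorHom, cupCochain_id_comp, cupCochain_id_comp, cechD_cupCochain, hf,
    cupCochain_zero_right, smul_zero, add_zero, Category.comp_id]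

lemma cupCochain_cechε :
    cupCochain (zero_add 0) (cechε E) (cechε E) = cechε E ≫ diag E.sieve₀.functor := by
  refine free_hom_ext fun V x ↦ ?_
  rw [cupCochain_gen]
  change _ = (diag E.sieve₀.functor).app V ((cechε E).app V (gen x))
  rw [cechε_gen, cechε_gen, cechε_gen, diag_gen]
  rfl

lemma diag_naturality {X Y : Cᵒᵖ ⥤ Type u} (f : X ⟶ Y) :
    free.map f ≫ diag Y = diag X ≫ (free.map f ⊗ₘ free.map f) := by
  refine free_hom_ext fun V x ↦ ?_
  change (diag Y).app V ((free.map f).app V (gen x)) =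
    (free.map f ⊗ₘ free.map f).app V ((diag X).app V (gen x))
  rw [free_map_gen, diag_gen, diag_gen]
  change _ = (free.map f).app V (gen x) ⊗ₜ (free.map f).app V (gen x)
  rw [free_map_gen]

/-- The map from Čech cohomology to the derived functors of `Ȟ⁰(E, -)` takes the
Alexander–Whitney cup product to the derived cup product. -/
lemma toExt_cechCup (P Q : Cᵒᵖ ⥤ Ab.{u}) (r s : ℕ) (x : (cechRes E).Cohomology P r)
    (y : (cechRes E).Cohomology Q s) :
    (cechRes E).toExt (P ⊗ Q) (r + s) (cechCup E P Q r s x y) =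
      presheafCup E ((cechRes E).toExt P r x) ((cechRes E).toExt Q s y) := by
  obtain ⟨a, rfl⟩ := QuotientAddGroup.mk_surjective x
  obtain ⟨b, rfl⟩ := QuotientAddGroup.mk_surjective y
  have hK := torsionFree_free E.sieve₀.functor
  have := HasTorsionFreeCovers.flat _ hK
  let φ (i j n : ℕ) (h : i + j = n) :
      free.obj (nerve E n) ⟶ free.obj (nerve E i) ⊗ free.obj (nerve E j) :=
    cupCochain h (𝟙 _) (𝟙 _)
  -- This is the Leibniz rule for the product of the `0`-cocycle `ε` with the identity cochain; the
  -- sign of the surviving term is `(-1)⁰`.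
  have hψ (j : ℕ) : (φ 0 (j + 1) (j + 1) (zero_add _) ≫ cechε E ▷ _) ≫ _ ◁ cechD E j =
      cechD E j ≫ φ 0 j j (zero_add _) ≫ cechε E ▷ _ := by
    simp only [φ]
    rw [Category.assoc, ← MonoidalCategory.tensorHom_def, ← tensorHom_id, cupCochain_comp,
      cupCochain_comp, cechD_cupCochain]
    simp [cechD_cechε, cupCochain_zero_left]
  obtain ⟨M, hM, κ, g, h₁, h₂⟩ := (cechRes E).exists_tensorVia_classHom a s (cechRes E) (cechRes E)
    hK (fun n ↦ torsionFree_free _) (diag _) (fun j ↦ φ 0 j j (zero_add j) ≫ cechε E ▷ _)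
    hψ (by
      change (cupCochain _ _ _ ≫ cechε E ▷ _) ≫ _ ◁ cechε E = cechε E ≫ diag _
      rw [Category.assoc, ← MonoidalCategory.tensorHom_def, cupCochain_id_comp, cupCochain_cechε])
    (fun i n h ↦ φ i s n h) (fun i n h h' Z f hf ↦ cupCochain_id_naturality E h h' f hf) rfl b
    (cupCocycles E P Q r s a b) (cupCochain_id_comp E rfl a.1 b.1).symm
  refine Eq.trans h₂.symm ?_
  change _ = presheafCup E ((cechRes E).classHom P r a) ((cechRes E).classHom Q s b)
  -- The syzygy factorization replaces the arbitrary one in the definition of the derived product.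
  rw [presheafCup, ← h₁, derivedTensor_eq torsionFree_unit_presheaf]

end Cech

variable {C : Type u} [SmallCategory C] {J : GrothendieckTopology C} {U : C}

/-! ### Passage from presheaves to sheaves. -/

section Edge

variable (J) in
lemma torsionFree_unit_sheaf : TorsionFree (𝟙_ (Sheaf J Ab.{u})) :=
  (torsionFree_sheafify J torsionFree_unit_presheaf).of_iso
    (Functor.Monoidal.εIso (presheafToSheaf J Ab.{u}))

/-- `tensorToSheaf` is the adjoint transpose of the right hand side, and the left hand side
transposes it back. -/
lemma sheafify_tensorToSheaf (A B : Sheaf J Ab.{u}) :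
    (presheafToSheaf J Ab.{u}).map (tensorToSheaf A B) ≫
        (sheafificationAdjunction J Ab.{u}).counit.app (A ⊗ B) =
      Functor.OplaxMonoidal.δ (presheafToSheaf J Ab.{u}) A.obj B.obj ≫
        ((sheafificationAdjunction J Ab.{u}).counit.app A ⊗ₘ
          (sheafificationAdjunction J Ab.{u}).counit.app B) :=
  ((sheafificationAdjunction J Ab.{u}).homEquiv_counit _ _ _).symm.trans (Equiv.symm_apply_apply _ _)

/-- The inclusion of `S` into the presheaf represented by `U` respects diagonals, and it becomes
invertible after sheafification. -/
lemma sieveIso_inv_diag {S : Sieve U} (hS : S ∈ J U) :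
    (sieveIso hS).inv ≫ (presheafToSheaf J Ab.{u}).map (diag S.functor) ≫
        Functor.OplaxMonoidal.δ (presheafToSheaf J Ab.{u}) _ _ =
      zDiag J U ≫ ((sieveIso hS).inv ⊗ₘ (sieveIso hS).inv) := by
  have h₁ : (presheafToSheaf J Ab.{u}).map (diag S.functor) ≫
      Functor.OplaxMonoidal.δ (presheafToSheaf J Ab.{u}) _ _ ≫
        ((sieveIso hS).hom ⊗ₘ (sieveIso hS).hom) = (sieveIso hS).hom ≫ zDiag J U := by
    change _ ≫ _ ≫ ((presheafToSheaf J Ab.{u}).map _ ⊗ₘ (presheafToSheaf J Ab.{u}).map _) =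
      (presheafToSheaf J Ab.{u}).map _ ≫ (presheafToSheaf J Ab.{u}).map _ ≫ _
    rw [Functor.OplaxMonoidal.δ_natural, ← Functor.map_comp_assoc, ← Functor.map_comp_assoc,
      diag_naturality]
  rw [Iso.inv_comp_eq, ← reassoc_of% h₁, tensorHom_comp_tensorHom, Iso.hom_inv_id, id_tensorHom_id,
    Category.comp_id]

/-- The edge morphisms take the derived cup product of presheaves to the cup product of derived
functor cohomology. -/
lemma edge_presheafCup {E : PreZeroHypercover.{u} U} (hE : E.sieve₀ ∈ J U) (A B : Sheaf J Ab.{u})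
    {r s : ℕ} (x : Ext.{u} (free.obj E.sieve₀.functor) A.obj r)
    (y : Ext.{u} (free.obj E.sieve₀.functor) B.obj s) :
    edge hE (A ⊗ B) (r + s) ((presheafCup E x y).comp
        (Ext.mk₀ (tensorToSheaf A B)) (add_zero (r + s))) =
      cup (edge hE A r x) (edge hE B s y) := by
  have hK := torsionFree_free E.sieve₀.functor
  have hK' := torsionFree_sheafify J hK
  -- `h₁` moves the product to sheaves, and `h₂` replaces sources by `ℤ_U` and coefficients by `A`
  -- and `B`. The rest is associativity and the two preceding compatibilities, for coefficients and
  -- for diagonals.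
  have h₁ := mapExactFunctor_derivedTensor (presheafToSheaf J Ab.{u}) torsionFree_unit_presheaf
    (torsionFree_unit_sheaf J) (fun M hM ↦ torsionFree_sheafify J hM) hK hK x y
  have h₂ := derivedTensor_naturality (torsionFree_unit_sheaf J) hK' hK' (torsionFree_zSheaf J U)
    (torsionFree_zSheaf J U) (sieveIso hE).inv (sieveIso hE).inv
    ((sheafificationAdjunction J Ab.{u}).counit.app A)
    ((sheafificationAdjunction J Ab.{u}).counit.app B)
    (x.mapExactFunctor (presheafToSheaf J Ab.{u})) (y.mapExactFunctor (presheafToSheaf J Ab.{u}))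
  rw [edge_apply, edge_apply, edge_apply, cup, h₂, presheafCup, Ext.mapExactFunctor_comp,
    Ext.mapExactFunctor_comp, Ext.mapExactFunctor_mk₀, Ext.mapExactFunctor_mk₀,
    Ext.comp_assoc_of_third_deg_zero, Ext.mk₀_comp_mk₀, sheafify_tensorToSheaf,
    ← Ext.mk₀_comp_mk₀,
    ← Ext.comp_assoc_of_third_deg_zero
      ((Ext.mk₀ ((presheafToSheaf J Ab.{u}).map (diag E.sieve₀.functor))).comp _ _) (Ext.mk₀ _),
    Ext.comp_assoc_of_third_deg_zero
      (Ext.mk₀ ((presheafToSheaf J Ab.{u}).map (diag E.sieve₀.functor))) _ (Ext.mk₀ _), h₁,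
    Ext.mk₀_comp_mk₀_assoc, Ext.comp_assoc_of_third_deg_zero, Ext.mk₀_comp_mk₀_assoc,
    Ext.mk₀_comp_mk₀_assoc, sieveIso_inv_diag]

/-- The edge morphisms are compatible with the cup product of Čech cohomology. -/
lemma cechToH_sheafCechCup {E : PreZeroHypercover.{u} U} (hE : E.sieve₀ ∈ J U)
    (A B : Sheaf J Ab.{u}) (r s : ℕ) (x : (cechRes E).Cohomology A.obj r)
    (y : (cechRes E).Cohomology B.obj s) :
    cechToH hE (A ⊗ B) (r + s) (sheafCechCup E A B r s x y) =
      cup (cechToH hE A r x) (cechToH hE B s y) := by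
  change edge hE (A ⊗ B) (r + s) ((cechRes E).toExt _ _
    ((cechRes E).mapCoeff (tensorToSheaf A B) (r + s) (cechCup E A.obj B.obj r s x y))) = _
  rw [Resolution.toExt_mapCoeff, toExt_cechCup, edge_presheafCup]
  rfl

lemma exists_isAlexanderWhitney {E : PreZeroHypercover.{u} U} {A B : Sheaf J Ab.{u}} {r s : ℕ}
    (a : (cechRes E).cocycles A.obj r) (b : (cechRes E).cocycles B.obj s) :
    ∃ c : (cechRes E).cocycles (A ⊗ B).obj (r + s), IsAlexanderWhitney a.1 b.1 c.1 := by
  refine ⟨⟨cupCochain rfl a.1 b.1 ≫ tensorToSheaf A B, ?_⟩, fun V x ↦ ?_⟩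
  · change cechD E (r + s) ≫ cupCochain rfl a.1 b.1 ≫ tensorToSheaf A B = 0
    rw [← Category.assoc, cechD_cupCochain_eq_zero rfl a.1 b.1 a.2 b.2, zero_comp]
  · exact congrArg ((tensorToSheaf A B).app V) (cupCochain_gen rfl a.1 b.1 x)

lemma cup_cechToH_mk {E : PreZeroHypercover.{u} U} (hE : E.sieve₀ ∈ J U) {A B : Sheaf J Ab.{u}}
    {r s : ℕ} (a : (cechRes E).cocycles A.obj r) (b : (cechRes E).cocycles B.obj s)
    (c : (cechRes E).cocycles (A ⊗ B).obj (r + s)) (h : IsAlexanderWhitney a.1 b.1 c.1) :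
    cup (cechToH hE A r (QuotientAddGroup.mk a)) (cechToH hE B s (QuotientAddGroup.mk b)) =
      cechToH hE (A ⊗ B) (r + s) (QuotientAddGroup.mk c) := by
  rw [← cechToH_sheafCechCup, sheafCechCup_mk a b c h]

/-- The edge morphisms of the colimit over all coverings are compatible with the cup products. -/
lemma limToH_sheafLimCup {A B : Sheaf J Ab.{u}} {r s : ℕ} (x : CechH J U A.obj r)
    (y : CechH J U B.obj s) :
    limToH (A ⊗ B) (r + s) (sheafLimCup x y) = cup (limToH A r x) (limToH B s y) := by
  obtain ⟨S, a, b, rfl, rfl⟩ := exists_cechι₂ x y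
  rw [sheafLimCup_cechι, limToH_cechι, limToH_cechι, limToH_cechι, cechToH_sheafCechCup]

end Edge

/-! ### Čech cochains as cochains on a resolution by sheaves. -/

section LowDegrees

variable {K : Cᵒᵖ ⥤ Ab.{u}} (R : Resolution K) (F : Sheaf J Ab.{u})

/-- The cochain with values in a sheaf on the associated resolution by sheaves which is defined by
a cochain. -/
abbrev sheafCochain {P : Cᵒᵖ ⥤ Ab.{u}} (a : P ⟶ F.obj) : (presheafToSheaf J Ab.{u}).obj P ⟶ F :=
  ((sheafificationAdjunction J Ab.{u}).homEquiv P F).symm a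

lemma comp_sheafCochain {P Q : Cᵒᵖ ⥤ Ab.{u}} (f : P ⟶ Q) (a : Q ⟶ F.obj) :
    (presheafToSheaf J Ab.{u}).map f ≫ sheafCochain F a = sheafCochain F (f ≫ a) :=
  ((sheafificationAdjunction J Ab.{u}).homEquiv_naturality_left_symm f a).symm

lemma sheafCochain_eq_zero {P : Cᵒᵖ ⥤ Ab.{u}} (a : P ⟶ F.obj) :
    sheafCochain F a = 0 ↔ a = 0 := by
  rw [← (((sheafificationAdjunction J Ab.{u}).homEquiv P F).symm.injective.eq_iff (b := 0))]
  have h : sheafCochain F (0 : P ⟶ F.obj) = 0 := by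
    rw [sheafCochain, Adjunction.homEquiv_counit, Functor.map_zero, zero_comp]
  rw [← h]

lemma mem_cocycles_sheafCochain {n : ℕ} (a : R.X n ⟶ F.obj) :
    sheafCochain F a ∈ (R.map (presheafToSheaf J Ab.{u})).cocycles F n ↔ a ∈ R.cocycles F.obj n := by
  rw [R.mem_cocycles, ← sheafCochain_eq_zero, ← comp_sheafCochain]
  rfl

/-- Sheafification turns `R` into a resolution of a sheaf isomorphic to `ℤ_U`, with the same
`F`-valued cochains by adjunction. Questions about the edge morphism thus become questions about
`classHom` for a single resolution of sheaves. -/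
lemma edge_classHom {S : Sieve U} (hS : S ∈ J U) (R : Resolution (free.obj S.functor)) (n : ℕ)
    (a : R.cocycles F.obj n) :
    edge hS F n (R.classHom F.obj n a) = (Ext.mk₀ (sieveIso hS).inv).comp
      ((R.map (presheafToSheaf J Ab.{u})).classHom F n
        ⟨sheafCochain F a.1, (mem_cocycles_sheafCochain R F a.1).2 a.2⟩) (zero_add n) := by
  rw [edge_apply, ← Resolution.classHom_map]
  congr 1
  symm
  refine Resolution.classHom_comp _ _ _ _ _ ?_
  exact ((sheafificationAdjunction J Ab.{u}).homEquiv_counit _ _ _).symm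

end LowDegrees

/-! ### Dimension shifting in degrees zero and one. -/

namespace Resolution

variable {𝒜 : Type u} [Category.{v} 𝒜] [Abelian 𝒜] [HasExt.{w} 𝒜] {K : 𝒜} (R : Resolution K) {F : 𝒜}

/-- In degree one, if the product of the extension class with the morphism `kernel R.ε ⟶ F` given by
`a` vanishes, this morphism extends to `R.X 0`, and the coboundary of the extension is `a`. From
degree two on, the groups `Ext` of the terms of the resolution obstruct the argument. -/
lemma mem_coboundaries_of_classHom_eq_zero : ∀ {n : ℕ} (_ : n ≤ 1) (a : R.cocycles F n),
    (R.classHom F n a : Ext.{w} K F n) = 0 → a.1 ∈ R.coboundaries F n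
  | 0, _, a, h => by
    rw [classHom_zero, Ext.mk₀_eq_zero_iff] at h
    change a.1 = 0
    rw [← ε_desc₀, h, comp_zero]
  | 1, _, a, h => by
    obtain ⟨y, hy⟩ := Ext.contravariant_sequence_exact₁ R.head_shortExact F _
      (Nat.add_comm 1 0) h
    obtain ⟨f, rfl⟩ := (Ext.mk₀_bijective _ _).2 y
    have hy' := (Ext.mk₀_bijective _ _).1 ((Ext.mk₀_comp_mk₀ _ _).symm.trans hy)
    refine ⟨f, ?_⟩
    have e := R.shift.ε_desc₀ F (R.shiftCocycles F 0 a)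
    rw [← hy'] at e
    refine Eq.trans ?_ e
    change R.d 0 ≫ f = kernel.lift R.ε (R.d 0) R.d_ε ≫ kernel.ι R.ε ≫ f
    rw [kernel.lift_ι_assoc]

lemma exists_classHom_zero (x : Ext.{w} K F 0) : ∃ a : R.cocycles F 0, R.classHom F 0 a = x := by
  obtain ⟨f, rfl⟩ := (Ext.mk₀_bijective _ _).2 x
  let a : R.cocycles F 0 := ⟨R.ε ≫ f, by rw [mem_cocycles, ← Category.assoc, R.d_ε, zero_comp]⟩
  have := R.epi
  refine ⟨a, (R.classHom_zero F a).trans (congrArg Ext.mk₀ ?_)⟩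
  rw [← cancel_epi R.ε, ε_desc₀]

/-- By the long exact sequence of `R.head`, a class that dies on `R.X 0` comes from a morphism
`kernel R.ε ⟶ F`, which is the same as a `1`-cocycle. -/
lemma exists_classHom_one (x : Ext.{w} K F 1) (h : (Ext.mk₀ R.ε).comp x (zero_add 1) = 0) :
    ∃ a : R.cocycles F 1, R.classHom F 1 a = x := by
  obtain ⟨y, rfl⟩ := Ext.contravariant_sequence_exact₃ R.head_shortExact F x h (add_zero 1)
  obtain ⟨a, rfl⟩ := R.shift.exists_classHom_zero y
  exact ⟨⟨a.1, a.2⟩, R.classHom_succ F 0 ⟨a.1, a.2⟩⟩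

end Resolution

/-! ### Čech and derived functor cohomology in degrees zero and one. -/

section LowDegrees

lemma mem_coboundaries_of_sheafCochain {K : Cᵒᵖ ⥤ Ab.{u}} (R : Resolution K) (F : Sheaf J Ab.{u}) :
    ∀ {n : ℕ} (a : R.X n ⟶ F.obj),
      sheafCochain F a ∈ (R.map (presheafToSheaf J Ab.{u})).coboundaries F n →
        a ∈ R.coboundaries F.obj n
  | 0, a, h => (sheafCochain_eq_zero F a).1 h
  | n + 1, a, ⟨b, hb⟩ => by
    let b' : R.X n ⟶ F.obj := (sheafificationAdjunction J Ab.{u}).homEquiv _ _ b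
    have e : sheafCochain F b' = b := Equiv.symm_apply_apply _ _
    refine ⟨b', ?_⟩
    refine ((sheafificationAdjunction J Ab.{u}).homEquiv _ _).symm.injective ?_
    refine (comp_sheafCochain F (R.d n) b').symm.trans ?_
    rw [e]
    exact hb

/-- Injectivity holds for each covering family separately, before any passage to the limit; only
surjectivity in degree one needs refinement. -/
lemma cechToH_injective {E : PreZeroHypercover.{u} U} (hE : E.sieve₀ ∈ J U) (F : Sheaf J Ab.{u})
    {n : ℕ} (hn : n ≤ 1) : Function.Injective (cechToH hE F n) := by
  rw [injective_iff_map_eq_zero]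
  intro x hx
  obtain ⟨a, rfl⟩ := QuotientAddGroup.mk_surjective x
  have h : edge hE F n ((cechRes E).classHom F.obj n a) = 0 := hx
  rw [edge_classHom] at h
  have h' := congrArg (fun z ↦ (Ext.mk₀ (sieveIso hE).hom).comp z (zero_add n)) h
  simp only [Ext.mk₀_comp_mk₀_assoc, Iso.hom_inv_id, Ext.mk₀_id_comp, Ext.comp_zero] at h'
  exact (QuotientAddGroup.eq_zero_iff _).2 (mem_coboundaries_of_sheafCochain _ F a.1
    (Resolution.mem_coboundaries_of_classHom_eq_zero _ hn _ h'))

lemma exists_cechToH_eq {E : PreZeroHypercover.{u} U} (hE : E.sieve₀ ∈ J U) (F : Sheaf J Ab.{u})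
    {n : ℕ} (ξ : H U F n)
    (α : ((cechRes E).map (presheafToSheaf J Ab.{u})).cocycles F n)
    (h : Resolution.classHom _ F n α = (Ext.mk₀ (sieveIso hE).hom).comp ξ (zero_add n)) :
    ∃ x, cechToH hE F n x = ξ := by
  let a₀ : (cechRes E).X n ⟶ F.obj := (sheafificationAdjunction J Ab.{u}).homEquiv _ _ α.1
  have e : sheafCochain F a₀ = α.1 := Equiv.symm_apply_apply _ _
  let a : (cechRes E).cocycles F.obj n :=
    ⟨a₀, (mem_cocycles_sheafCochain _ F a₀).1 (by rw [e]; exact α.2)⟩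
  refine ⟨QuotientAddGroup.mk a, ?_⟩
  change edge hE F n ((cechRes E).classHom F.obj n a) = ξ
  have ha : (⟨sheafCochain F a.1, (mem_cocycles_sheafCochain _ F a.1).2 a.2⟩ :
      ((cechRes E).map (presheafToSheaf J Ab.{u})).cocycles F n) = α := Subtype.ext e
  rw [edge_classHom, ha, h, Ext.mk₀_comp_mk₀_assoc, Iso.inv_hom_id, Ext.mk₀_id_comp]

/-- Locally on `U`, the canonical section of `ℤ_U` lifts along an epimorphism to `ℤ_U`. -/
lemma exists_local_lift {M : Sheaf J Ab.{u}} (p : M ⟶ zSheaf J U) [Epi p] :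
    ∃ (S : J.Cover U) (t : (presheafToSheaf J Ab.{u}).obj (free.obj (nerve (family S) 0)) ⟶ M),
      t ≫ p = (presheafToSheaf J Ab.{u}).map (cechε (family S)) ≫
        (sieveIso (family_mem S)).hom := by
  let η : free.obj (yoneda.obj U) ⟶ (zSheaf J U).obj :=
    (sheafificationAdjunction J Ab.{u}).unit.app (free.obj (yoneda.obj U))
  -- `σ` is the canonical section of `ℤ_U`. An epimorphism of sheaves is locally surjective, so `σ`
  -- lifts to `M` on the arrows of a covering sieve `S`.
  let σ : (zSheaf J U).obj.obj (op U) := η.app (op U) (gen (X := yoneda.obj U) (V := op U) (𝟙 U))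
  have : Sheaf.IsLocallySurjective p := (Sheaf.isLocallySurjective_iff_epi' Ab.{u} p).2 inferInstance
  let S : J.Cover U := ⟨Presheaf.imageSieve p.hom σ, Presheaf.imageSieve_mem J p.hom σ⟩
  let e (i : S.Arrow) : M.obj.obj (op i.Y) := Presheaf.localPreimage p.hom σ i.f i.hf
  have he (i : S.Arrow) : p.hom.app (op i.Y) (e i) = (zSheaf J U).obj.map i.f.op σ :=
    Presheaf.app_localPreimage p.hom σ i.f i.hf
  -- The local lifts `e i` need not agree on overlaps: the presheaf `N_0` is a disjoint union of
  -- representable presheaves, one for each arrow of `S`, so any choice defines a morphism.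
  let τ : nerve (family S) 0 ⟶ M.obj ⋙ forget _ :=
    { app V := TypeCat.ofHom fun x ↦ M.obj.map (x.1 0).2.op (e (x.1 0).1)
      naturality V W f := by
        ext x
        exact congrArg (fun g ↦ g.hom (e (x.1 0).1)) (M.obj.map_comp (x.1 0).2.op f) }
  let t := (freeAdj.homEquiv _ _).symm τ
  have ht : t ≫ p.hom = (cechε (family S) ≫ free.map (family S).sieve₀.functorInclusion) ≫ η := by
    refine free_hom_ext fun V x ↦ ?_
    have h₁ : t.app V (gen x) = M.obj.map (x.1 0).2.op (e (x.1 0).1) :=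
      value_homEquiv_symm (P := M.obj) τ x
    change p.hom.app V (t.app V (gen x)) =
      η.app V ((free.map _).app V ((cechε (family S)).app V (gen x)))
    rw [h₁, cechε_gen, free_map_gen]
    -- By the Yoneda lemma, `η` is determined by `σ`.
    have h₂ (f : V.unop ⟶ U) :
        η.app V (gen (X := yoneda.obj U) f) = (zSheaf J U).obj.map f.op σ := by
      refine Eq.trans ?_ (NatTrans.naturality_apply η f.op
        (gen (X := yoneda.obj U) (V := op U) (𝟙 U)))
      refine congrArg (η.app V) (Eq.symm ?_)
      refine (ModuleCat.free_map_apply _ _).trans ?_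
      exact congrArg (gen (X := yoneda.obj U) (V := V)) (Category.comp_id f)
    refine (NatTrans.naturality_apply p.hom (x.1 0).2.op (e (x.1 0).1)).trans ?_
    refine (congrArg ((zSheaf J U).obj.map (x.1 0).2.op) (he (x.1 0).1)).trans ?_
    refine Eq.trans ?_ (h₂ ((x.1 0).2 ≫ (x.1 0).1.f)).symm
    exact (congrArg (fun g ↦ g.hom σ)
      ((zSheaf J U).obj.map_comp (x.1 0).1.f.op (x.1 0).2.op)).symm
  refine ⟨S, sheafCochain M t, ?_⟩
  have h₂ : sheafCochain (zSheaf J U) η = 𝟙 _ := by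
    exact ((sheafificationAdjunction J Ab.{u}).homEquiv_counit _ _ _).trans
      ((sheafificationAdjunction J Ab.{u}).left_triangle_components _)
  have h₃ : sheafCochain M t ≫ p = sheafCochain (zSheaf J U) (t ≫ p.hom) :=
    ((sheafificationAdjunction J Ab.{u}).homEquiv_naturality_right_symm t p).symm
  rw [h₃, ht, ← comp_sheafCochain, h₂]
  exact (Category.comp_id _).trans (Functor.map_comp _ _ _)

/-- In degrees zero and one, Čech cohomology agrees with derived functor cohomology. -/
lemma limToH_bijective (F : Sheaf J Ab.{u}) {n : ℕ} (hn : n ≤ 1) :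
    Function.Bijective (limToH (U := U) F n) := by
  refine ⟨(injective_iff_map_eq_zero _).2 fun x hx ↦ ?_, fun ξ ↦ ?_⟩
  · obtain ⟨S, a, rfl⟩ := exists_cechι x
    rw [limToH_cechι] at hx
    rw [(injective_iff_map_eq_zero _).1 (cechToH_injective (family_mem S) F hn) a hx, map_zero]
  · suffices h : ∃ (S : J.Cover U) (x : _), cechToH (family_mem S) F n x = ξ by
      obtain ⟨S, x, h⟩ := h
      exact ⟨cechι S F.obj n x, (limToH_cechι S F n x).trans h⟩
    match n, hn, ξ with
    -- In degree zero every covering suffices, and the maximal sieve is taken.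
    | 0, _, ξ =>
      obtain ⟨α, hα⟩ := Resolution.exists_classHom_zero
        ((cechRes (family (⊤ : J.Cover U))).map (presheafToSheaf J Ab.{u}))
        ((Ext.mk₀ (sieveIso (family_mem ⊤)).hom).comp ξ (zero_add 0))
      exact ⟨⊤, exists_cechToH_eq _ F ξ α hα⟩
    | 1, _, ξ =>
      -- The covering is chosen such that the augmentation of its sheafified Čech resolution factors
      -- through an epimorphism killing `ξ`, which is the vanishing on `X 0` needed to find a
      -- cocycle.
      obtain ⟨M, p, hp, h⟩ := exists_epi_comp_eq_zero 0 ξ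
      obtain ⟨S, t, ht⟩ := exists_local_lift p
      obtain ⟨α, hα⟩ := Resolution.exists_classHom_one
        ((cechRes (family S)).map (presheafToSheaf J Ab.{u}))
        ((Ext.mk₀ (sieveIso (family_mem S)).hom).comp ξ (zero_add 1)) (by
          rw [Ext.mk₀_comp_mk₀_assoc]
          change (Ext.mk₀ ((presheafToSheaf J Ab.{u}).map (cechε (family S)) ≫ _)).comp _ _ = 0
          rw [← ht, ← Ext.mk₀_comp_mk₀_assoc, h, Ext.comp_zero])
      exact ⟨S, exists_cechToH_eq _ F ξ α hα⟩

end LowDegrees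

end

end CechCup

/-! ### The comparison theorem. -/

theorem mainTheorem6 {C : Type u} [SmallCategory C] (J : GrothendieckTopology C) (U : C) :
    -- The cup product of the derived functors of `Ȟ⁰(E, -)` is given by the Alexander–Whitney
    -- product of Čech cocycles.
    (∀ (E : PreZeroHypercover.{u} U) (P Q : Cᵒᵖ ⥤ CechCup.Ab.{u}) (r s : ℕ)
      (x : (CechCup.cechRes E).Cohomology P r) (y : (CechCup.cechRes E).Cohomology Q s),
      (CechCup.cechRes E).toExt (P ⊗ Q) (r + s) (CechCup.cechCup E P Q r s x y) =
        CechCup.presheafCup E ((CechCup.cechRes E).toExt P r x)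
          ((CechCup.cechRes E).toExt Q s y)) ∧
    -- The comparison for a covering family `E` of `U`.
    (∀ (E : PreZeroHypercover.{u} U) (hE : E.sieve₀ ∈ J U) (A B : Sheaf J CechCup.Ab.{u})
      (r s : ℕ),
      -- The edge morphisms are compatible with the cup products of the derived functors.
      (∀ (x : Ext.{u} (CechCup.free.obj E.sieve₀.functor) A.obj r)
        (y : Ext.{u} (CechCup.free.obj E.sieve₀.functor) B.obj s),
        CechCup.edge hE (A ⊗ B) (r + s) ((CechCup.presheafCup E x y).comp
            (Ext.mk₀ (CechCup.tensorToSheaf A B)) (add_zero (r + s))) =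
          CechCup.cup (CechCup.edge hE A r x) (CechCup.edge hE B s y)) ∧
      -- The edge morphisms are compatible with the cup product of Čech cohomology.
      (∀ (x : (CechCup.cechRes E).Cohomology A.obj r) (y : (CechCup.cechRes E).Cohomology B.obj s),
        CechCup.cechToH hE (A ⊗ B) (r + s) (CechCup.sheafCechCup E A B r s x y) =
          CechCup.cup (CechCup.cechToH hE A r x) (CechCup.cechToH hE B s y)) ∧
      -- The Alexander–Whitney formula computes the cup product in derived functor cohomology.
      (∀ (a : (CechCup.cechRes E).cocycles A.obj r) (b : (CechCup.cechRes E).cocycles B.obj s),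
        ∃ c : (CechCup.cechRes E).cocycles (A ⊗ B).obj (r + s),
          CechCup.IsAlexanderWhitney a.1 b.1 c.1 ∧
          CechCup.cup (CechCup.cechToH hE A r (QuotientAddGroup.mk a))
              (CechCup.cechToH hE B s (QuotientAddGroup.mk b)) =
            CechCup.cechToH hE (A ⊗ B) (r + s) (QuotientAddGroup.mk c)) ∧
      -- If the cohomology groups agree, so do the cup products.
      (∀ (hA : Function.Bijective (CechCup.cechToH hE A r))
        (hB : Function.Bijective (CechCup.cechToH hE B s)) (ξ : CechCup.H U A r)
        (η : CechCup.H U B s),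
        CechCup.cup ξ η = CechCup.cechToH hE (A ⊗ B) (r + s) (CechCup.sheafCechCup E A B r s
          ((AddEquiv.ofBijective _ hA).symm ξ) ((AddEquiv.ofBijective _ hB).symm η)) ∧
        ∀ hAB : Function.Bijective (CechCup.cechToH hE (A ⊗ B) (r + s)),
          (AddEquiv.ofBijective _ hAB).symm (CechCup.cup ξ η) = CechCup.sheafCechCup E A B r s
            ((AddEquiv.ofBijective _ hA).symm ξ) ((AddEquiv.ofBijective _ hB).symm η))) ∧
    -- The comparison for the colimit over all coverings of `U`.
    (∀ (A B : Sheaf J CechCup.Ab.{u}) (r s : ℕ),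
      (∀ (x : CechCup.CechH J U A.obj r) (y : CechCup.CechH J U B.obj s),
        CechCup.limToH (A ⊗ B) (r + s) (CechCup.sheafLimCup x y) =
          CechCup.cup (CechCup.limToH A r x) (CechCup.limToH B s y)) ∧
      (∀ (hA : Function.Bijective (CechCup.limToH (U := U) A r))
        (hB : Function.Bijective (CechCup.limToH (U := U) B s)) (ξ : CechCup.H U A r)
        (η : CechCup.H U B s),
        CechCup.cup ξ η = CechCup.limToH (A ⊗ B) (r + s) (CechCup.sheafLimCup
          ((AddEquiv.ofBijective _ hA).symm ξ) ((AddEquiv.ofBijective _ hB).symm η)) ∧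
        ∀ hAB : Function.Bijective (CechCup.limToH (U := U) (A ⊗ B) (r + s)),
          (AddEquiv.ofBijective _ hAB).symm (CechCup.cup ξ η) = CechCup.sheafLimCup
            ((AddEquiv.ofBijective _ hA).symm ξ) ((AddEquiv.ofBijective _ hB).symm η))) ∧
    -- In degrees zero and one, the Čech cohomology of `U` agrees with derived functor cohomology.
    (∀ (F : Sheaf J CechCup.Ab.{u}) (n : ℕ), n ≤ 1 →
      Function.Bijective (CechCup.limToH (U := U) F n)) ∧
    -- The cup product `H¹(U, A) × H⁰(U, B) ⟶ H¹(U, A ⊗ B)` is computed by Čech cocycles.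
    (∀ (A B : Sheaf J CechCup.Ab.{u}) (ξ : CechCup.H U A 1) (η : CechCup.H U B 0),
      ∃ (S : J.Cover U) (a : (CechCup.cechRes (CechCup.family S)).cocycles A.obj 1)
        (b : (CechCup.cechRes (CechCup.family S)).cocycles B.obj 0)
        (c : (CechCup.cechRes (CechCup.family S)).cocycles (A ⊗ B).obj (1 + 0)),
        CechCup.cechToH (CechCup.family_mem S) A 1 (QuotientAddGroup.mk a) = ξ ∧
        CechCup.cechToH (CechCup.family_mem S) B 0 (QuotientAddGroup.mk b) = η ∧
        CechCup.IsAlexanderWhitney a.1 b.1 c.1 ∧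
        CechCup.cechToH (CechCup.family_mem S) (A ⊗ B) (1 + 0) (QuotientAddGroup.mk c) =
          CechCup.cup ξ η) := by
  refine ⟨CechCup.toExt_cechCup, fun E hE A B r s ↦ ⟨CechCup.edge_presheafCup hE A B,
    CechCup.cechToH_sheafCechCup hE A B r s, fun a b ↦ ?_, fun hA hB ξ η ↦ ?_⟩,
    fun A B r s ↦ ⟨CechCup.limToH_sheafLimCup, fun hA hB ξ η ↦ ?_⟩,
    fun F n hn ↦ CechCup.limToH_bijective F hn, fun A B ξ η ↦ ?_⟩
  · obtain ⟨c, hc⟩ := CechCup.exists_isAlexanderWhitney a b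
    exact ⟨c, hc, CechCup.cup_cechToH_mk hE a b c hc⟩
  · have h : CechCup.cup ξ η = CechCup.cechToH hE (A ⊗ B) (r + s) (CechCup.sheafCechCup E A B r s
        ((AddEquiv.ofBijective _ hA).symm ξ) ((AddEquiv.ofBijective _ hB).symm η)) := by
      rw [CechCup.cechToH_sheafCechCup]
      exact (congrArg₂ CechCup.cup ((AddEquiv.ofBijective _ hA).apply_symm_apply ξ)
        ((AddEquiv.ofBijective _ hB).apply_symm_apply η)).symm
    exact ⟨h, fun hAB ↦ (AddEquiv.symm_apply_eq _).2 h⟩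
  · have h : CechCup.cup ξ η = CechCup.limToH (A ⊗ B) (r + s) (CechCup.sheafLimCup
        ((AddEquiv.ofBijective _ hA).symm ξ) ((AddEquiv.ofBijective _ hB).symm η)) := by
      rw [CechCup.limToH_sheafLimCup]
      exact (congrArg₂ CechCup.cup ((AddEquiv.ofBijective _ hA).apply_symm_apply ξ)
        ((AddEquiv.ofBijective _ hB).apply_symm_apply η)).symm
    exact ⟨h, fun hAB ↦ (AddEquiv.symm_apply_eq _).2 h⟩
  -- Both classes come from the limit by surjectivity in degrees one and zero. They are then
  -- represented on one common covering, where the Alexander–Whitney formula applies.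
  · obtain ⟨x, rfl⟩ := (CechCup.limToH_bijective A le_rfl).2 ξ
    obtain ⟨y, rfl⟩ := (CechCup.limToH_bijective B zero_le_one).2 η
    obtain ⟨S, x, y, rfl, rfl⟩ := CechCup.exists_cechι₂ x y
    obtain ⟨a, rfl⟩ := QuotientAddGroup.mk_surjective x
    obtain ⟨b, rfl⟩ := QuotientAddGroup.mk_surjective y
    obtain ⟨c, hc⟩ := CechCup.exists_isAlexanderWhitney a b
    refine ⟨S, a, b, c, (CechCup.limToH_cechι S A 1 _).symm, (CechCup.limToH_cechι S B 0 _).symm,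
      hc, ?_⟩
    rw [CechCup.limToH_cechι, CechCup.limToH_cechι]
    exact (CechCup.cup_cechToH_mk (CechCup.family_mem S) a b c hc).symm
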